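/- Let $N\ge 2$. Consider the bipartite Bell scenario in which Alice has settings $A_1,A_3,\dots,A_{2N-1}$, Bob has settings $B_2,B_4,\dots,B_{2N}$, and all outcomes lie in $\{1,-1\}$. A realization consists of a unit vector $\psi\in\mathcal H_A\otimes\mathcal H_B$ (complex inner product spaces) and orthogonal projections $\Pi^A_{a|x}$ on $\mathcal H_A$, $\Pi^B_{b|y}$ on $\mathcal H_B$; it consists of projective measurements if $\Pi^A_{1|x}+\Pi^A_{-1|x}=I$ and $\Pi^B_{1|y}+\Pi^B_{-1|y}=I$ for all $x,y$, and it is rank-one if all these projections have rank one. Put $P(a,b|x,y)=\langle\psi,(\Pi^A_{a|x}\otimes\Pi^B_{b|y})\psi\rangle$, $\langle A_xB_y\rangle=\sum_{a,b}ab\,P(a,b|x,y)$, and let $$I_N=\langle A_1B_2\rangle+\langle A_3B_2\rangle+\langle A_3B_4\rangle+\langle A_5B_4\rangle+\cdots+\langle A_{2N-1}B_{2N}\rangle-\langle A_1B_{2N}\rangle$$ be the chained Bell expression. The reference realization is the state $\psi_0=(|00\rangle+|11\rangle)/\sqrt2\in\mathbb C^2\otimes\mathbb C^2$ with the eigenprojections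 $P_{a|x},Q_{b|y}$ of the observables $\cos\varphi_k\,Z+\sin\varphi_k\,X$, $\varphi_k=(k-1)\pi/(2N)$, where $k=1,3,\dots,2N-1$ for Alice and $k=2,4,\dots,2N$ for Bob ($Z,X$ are the Pauli matrices). The events of $I_N$ are the $4N$ events $(a,b|x,y)$ with $(x,y)$ occurring in $I_N$ and $ab$ equal to the sign of $\langle A_xB_y\rangle$ in $I_N$; two events are exclusive if some party has the same setting but different outcomes in them. Let $G_N$ be the graph of exclusivity. The theta program of $G_N$ is to maximize $\sum_i X_{ii}$ over positive semidefinite matrices $X$ indexed by $\{0\}$ and the events, with $X_{00}=1$, $X_{ii}=X_{0i}$ for every event $i$, and $X_{ij}=0$ for $i\sim j$. The matrix of a realization is $X_{ij}=\langle\psi,\Pi_j\Pi_i\psi\rangle$ with $\Pi_0=I$ and $\Pi_i=\Pi^A_{a|x}\otimes\Pi^B_{b|y}$ for $i=(a,b|x,y)$. Then: (1) The reference realization consists of rank-one projective measurements and attains $I_N=2N\cos(\pi/2N)$; every realization by projective measurements (of any ranks) satisfies $I_N\le 2N\cos(\pi/2N)$. (2) (Self-testing) For every realization $(\psi',\{\Pi'^A_{a|x}\},\{\Pi'^B_{b|y}\})$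 on $\mathcal H_A'\otimes\mathcal H_B'$ by rank-one projective measurements that attains $I_N=2N\cos(\pi/2N)$ there are unitaries $V_A:\mathbb C^2\to\mathcal H_A'$ and $V_B:\mathbb C^2\to\mathcal H_B'$ such that $(V_A\otimes V_B)\psi_0=\psi'$ and $(V_A\otimes V_B)(P_{a|x}\otimes Q_{b|y})\psi_0=(\Pi'^A_{a|x}\otimes\Pi'^B_{b|y})\psi'$ for all $a,b,x,y$. (3) $G_N$ is isomorphic to the Möbius ladder $Ci_{4N}(1,2N)$, its Lovász theta number is $N(1+\cos(\pi/2N))$, and the matrix of the reference realization is the unique maximizer of the theta program of $G_N$. (4) For every rank-one realization $(\psi',\{\Pi'^A_{a|x}\},\{\Pi'^B_{b|y}\})$ on $\mathcal H_A'\otimes\mathcal H_B'$ (the projections of a setting need not sum to the identity) whose matrix is a maximizer of the theta program of $G_N$ there are isometries $V_A:\mathbb C^2\to\mathcal H_A'$ and $V_B:\mathbb C^2\to\mathcal H_B'$ with $(V_A\otimes V_B)\psi_0=\psi'$ and $(V_A\otimes V_B)(P_{a|x}\otimes Q_{b|y})\psi_0=(\Pi'^A_{a|x}\otimes\Pi'^B_{b|y})\psi'$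 for all $a,b,x,y$. -/

import Mathlib

open scoped TensorProduct ComplexOrder

universe u v

/-! ### Bipartite quantum realizations with `N` two-outcome settings per party -/

/-- A quantum realization for two parties with `N` settings each and outcomes in `{1, -1} = ℤˣ`:
a unit vector in the tensor product of the two local (complex inner product) spaces, and an
orthogonal projection for each party, setting and outcome. That the two projections of a setting
form a measurement is the separate predicate `IsMeasurement`. -/
structure BellRealization (N : ℕ) (HA HB : Type*)
    [NormedAddCommGroup HA] [InnerProductSpace ℂ HA]
    [NormedAddCommGroup HB] [InnerProductSpace ℂ HB] where
  /-- the shared state -/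
  state : HA ⊗[ℂ] HB
  norm_state : ‖state‖ = 1
  /-- `projA x a` is Alice's projection for outcome `a` of setting `x` -/
  projA : Fin N → ℤˣ → (HA →ₗ[ℂ] HA)
  /-- `projB y b` is Bob's projection for outcome `b` of setting `y` -/
  projB : Fin N → ℤˣ → (HB →ₗ[ℂ] HB)
  projA_isProj : ∀ x a, (projA x a).IsSymmetricProjection
  projB_isProj : ∀ y b, (projB y b).IsSymmetricProjection

namespace BellRealization

variable {N : ℕ} {HA HB : Type*}
  [NormedAddCommGroup HA] [InnerProductSpace ℂ HA]
  [NormedAddCommGroup HB] [InnerProductSpace ℂ HB]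

/-- For each setting the projections sum to the identity (so each setting is a projective
measurement). -/
def IsMeasurement (S : BellRealization N HA HB) : Prop :=
  (∀ x, ∑ a : ℤˣ, S.projA x a = LinearMap.id) ∧ (∀ y, ∑ b : ℤˣ, S.projB y b = LinearMap.id)

/-- All local projections have rank one. -/
def IsRankOne (S : BellRealization N HA HB) : Prop :=
  (∀ x a, Module.finrank ℂ (LinearMap.range (S.projA x a)) = 1) ∧
  (∀ y b, Module.finrank ℂ (LinearMap.range (S.projB y b)) = 1)

/-- The vector `(Π^A_{a|x} ⊗ Π^B_{b|y}) ψ`. -/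
noncomputable def eventVec (S : BellRealization N HA HB) (x y : Fin N) (a b : ℤˣ) : HA ⊗[ℂ] HB :=
  TensorProduct.map (S.projA x a) (S.projB y b) S.state

/-- The probability `P(a, b | x, y) = ⟨ψ, (Π^A_{a|x} ⊗ Π^B_{b|y}) ψ⟩`. -/
noncomputable def prob (S : BellRealization N HA HB) (x y : Fin N) (a b : ℤˣ) : ℝ :=
  (inner ℂ S.state (S.eventVec x y a b)).re

/-- The correlator `⟨A_x B_y⟩`, the expectation of the product of the outcomes. -/
noncomputable def correlator (S : BellRealization N HA HB) (x y : Fin N) : ℝ :=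
  ∑ a : ℤˣ, ∑ b : ℤˣ, (((a * b : ℤˣ) : ℤ) : ℝ) * S.prob x y a b

end BellRealization

/-! ### The chained Bell expression

Alice's `N` settings (traditionally labelled `1, 3, …, 2N-1`) are numbered `0, …, N-1`, and so are
Bob's (traditionally `2, 4, …, 2N`). The expression has `2N` terms, numbered by `e : Fin (2 * N)`:
`⟨A_1 B_2⟩, ⟨A_3 B_2⟩, ⟨A_3 B_4⟩, …, ⟨A_{2N-1} B_{2N}⟩, -⟨A_1 B_{2N}⟩`. -/

/-- Alice's setting in the `e`-th term: `0, 1, 1, 2, 2, …, N-1, N-1, 0`. -/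
def chainA {N : ℕ} (e : Fin (2 * N)) : Fin N :=
  ⟨((e : ℕ) + 1) / 2 % N, Nat.mod_lt _ (by have := e.isLt; omega)⟩

/-- Bob's setting in the `e`-th term: `0, 0, 1, 1, …, N-1, N-1`. -/
def chainB {N : ℕ} (e : Fin (2 * N)) : Fin N :=
  ⟨(e : ℕ) / 2, by have := e.isLt; omega⟩

/-- The sign of the `e`-th term: `-1` for the last term and `1` for the others. -/
def chainSign {N : ℕ} (e : Fin (2 * N)) : ℤˣ :=
  if (e : ℕ) + 1 = 2 * N then -1 else 1

/-- The chained Bell expression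
`⟨A_1 B_2⟩ + ⟨A_3 B_2⟩ + ⟨A_3 B_4⟩ + ⋯ + ⟨A_{2N-1} B_{2N}⟩ - ⟨A_1 B_{2N}⟩`. -/
noncomputable def chainedBell {N : ℕ} {HA HB : Type*}
    [NormedAddCommGroup HA] [InnerProductSpace ℂ HA]
    [NormedAddCommGroup HB] [InnerProductSpace ℂ HB] (S : BellRealization N HA HB) : ℝ :=
  ∑ e : Fin (2 * N), ((chainSign e : ℤ) : ℝ) * S.correlator (chainA e) (chainB e)

/-! ### The events of the chained Bell expression and their graph of exclusivity -/

/-- The `4N` events: the pair `(e, a)` is the event that, for the settings of the `e`-th term,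
Alice obtains `a` and Bob obtains `a` times the sign of the term. -/
abbrev ChainEvent (N : ℕ) : Type := Fin (2 * N) × ℤˣ

/-- Bob's outcome in an event. -/
def ChainEvent.outB {N : ℕ} (i : ChainEvent N) : ℤˣ := chainSign i.1 * i.2

/-- Two events are exclusive if one of the parties has the same setting and different outcomes
in them. -/
def chainedExclusivityGraph (N : ℕ) : SimpleGraph (ChainEvent N) where
  Adj i j :=
    (chainA i.1 = chainA j.1 ∧ i.2 ≠ j.2) ∨ (chainB i.1 = chainB j.1 ∧ i.outB ≠ j.outB)
  symm := ⟨fun _ _ h => h.imp (fun h => ⟨h.1.symm, h.2.symm⟩) (fun h => ⟨h.1.symm, h.2.symm⟩)⟩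
  loopless := ⟨fun _ h => h.elim (fun h => h.2 rfl) (fun h => h.2 rfl)⟩

/-! ### The Lovász theta semidefinite program -/

/-- Feasibility for the Lovász theta program of `G`; the extra index `0` is `none`. -/
structure ThetaFeasible {V : Type*} (G : SimpleGraph V) (X : Matrix (Option V) (Option V) ℂ) :
    Prop where
  posSemidef : X.PosSemidef
  corner : X none none = 1
  diag : ∀ i : V, X (some i) (some i) = X none (some i)
  edge : ∀ i j : V, G.Adj i j → X (some i) (some j) = 0

/-- The (unit weight) objective `∑ i, X i i` of the Lovász theta program. -/
noncomputable def thetaObjective {V : Type*} [Fintype V] (X : Matrix (Option V) (Option V) ℂ) : ℝ :=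
  ∑ i : V, (X (some i) (some i)).re

/-- `X` is a maximizer of the Lovász theta program of `G`. -/
def IsThetaOptimal {V : Type*} [Fintype V] (G : SimpleGraph V)
    (X : Matrix (Option V) (Option V) ℂ) : Prop :=
  ThetaFeasible G X ∧
    ∀ Y : Matrix (Option V) (Option V) ℂ, ThetaFeasible G Y → thetaObjective Y ≤ thetaObjective X

/-- The vectors `Π_i ψ` of a realization, where `Π_0` is the identity and, for an event `i`,
`Π_i` is the product of the local projections of `i`. -/
noncomputable def chainedVec {N : ℕ} {HA HB : Type*}
    [NormedAddCommGroup HA] [InnerProductSpace ℂ HA]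
    [NormedAddCommGroup HB] [InnerProductSpace ℂ HB] (S : BellRealization N HA HB) :
    Option (ChainEvent N) → HA ⊗[ℂ] HB
  | none => S.state
  | some i => S.eventVec (chainA i.1) (chainB i.1) i.2 i.outB

/-- The matrix `X i j = ⟨ψ, Π_j Π_i ψ⟩` of a realization. -/
noncomputable def chainedGram {N : ℕ} {HA HB : Type*}
    [NormedAddCommGroup HA] [InnerProductSpace ℂ HA]
    [NormedAddCommGroup HB] [InnerProductSpace ℂ HB] (S : BellRealization N HA HB) :
    Matrix (Option (ChainEvent N)) (Option (ChainEvent N)) ℂ :=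
  fun i j => inner ℂ (chainedVec S j) (chainedVec S i)

/-! ### The standard two-qubit realization -/

/-- The state space of a qubit. -/
abbrev Qubit : Type := EuclideanSpace ℂ (Fin 2)

/-- The qubit vector `cos t |0⟩ + sin t |1⟩`. -/
noncomputable def qubitVec (t : ℝ) : Qubit := !₂[(Real.cos t : ℂ), (Real.sin t : ℂ)]

theorem norm_qubitVec (t : ℝ) : ‖qubitVec t‖ = 1 := by
  rw [EuclideanSpace.norm_eq]
  simp only [qubitVec, Fin.sum_univ_two, Complex.norm_real, Real.norm_eq_abs, sq_abs,
    Matrix.cons_val_zero, Matrix.cons_val_one]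
  simp

/-- The eigenprojection for the eigenvalue `a` of the observable `cos φ Z + sin φ X`
(`Z`, `X` Pauli matrices): the projection onto `cos (φ/2) |0⟩ + sin (φ/2) |1⟩` for `a = 1` and
onto `-sin (φ/2) |0⟩ + cos (φ/2) |1⟩` for `a = -1`. -/
noncomputable def qubitProj (φ : ℝ) (a : ℤˣ) : Qubit →ₗ[ℂ] Qubit :=
  let v := qubitVec (if a = 1 then φ / 2 else φ / 2 + Real.pi / 2)
  (InnerProductSpace.rankOne ℂ v v).toLinearMap

theorem qubitProj_isSymmetricProjection (φ : ℝ) (a : ℤˣ) :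
    (qubitProj φ a).IsSymmetricProjection :=
  InnerProductSpace.isSymmetricProjection_rankOne_self (norm_qubitVec _)

/-- The maximally entangled state `(|00⟩ + |11⟩) / √2`. -/
noncomputable def phiPlus : Qubit ⊗[ℂ] Qubit :=
  ((1 / Real.sqrt 2 : ℝ) : ℂ) •
    (EuclideanSpace.single 0 1 ⊗ₜ[ℂ] EuclideanSpace.single 0 1 +
      EuclideanSpace.single 1 1 ⊗ₜ[ℂ] EuclideanSpace.single 1 1)

theorem norm_phiPlus : ‖phiPlus‖ = 1 := by
  have h : inner ℂ phiPlus phiPlus = (1 : ℂ) := by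
    have h2 : (1 / Real.sqrt 2) * (1 / Real.sqrt 2) = (1 / 2 : ℝ) := by
      rw [div_mul_div_comm, Real.mul_self_sqrt (by norm_num)]; norm_num
    unfold phiPlus
    rw [inner_smul_left (E := Qubit ⊗[ℂ] Qubit), inner_smul_right (E := Qubit ⊗[ℂ] Qubit),
      inner_add_left (E := Qubit ⊗[ℂ] Qubit), inner_add_right (E := Qubit ⊗[ℂ] Qubit),
      inner_add_right (E := Qubit ⊗[ℂ] Qubit), ← mul_assoc, Complex.conj_ofReal,
      ← Complex.ofReal_mul, h2]
    simp [EuclideanSpace.inner_single_left]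
    norm_num
  rw [@norm_eq_sqrt_re_inner ℂ, h]
  simp

/-- The standard two-qubit realization: the state `(|00⟩ + |11⟩) / √2` and, with the traditional
labels `k = 1, 3, …, 2N-1` of Alice's settings and `k = 2, 4, …, 2N` of Bob's, the observables
`cos φ_k Z + sin φ_k X`, where `φ_k = (k - 1) π / (2N)`. -/
noncomputable def chainedReference (N : ℕ) : BellRealization N Qubit Qubit where
  state := phiPlus
  norm_state := norm_phiPlus
  projA x a := qubitProj (2 * (x : ℕ) * (Real.pi / (2 * N))) a
  projB y b := qubitProj ((2 * (y : ℕ) + 1) * (Real.pi / (2 * N))) b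
  projA_isProj _ _ := qubitProj_isSymmetricProjection _ _
  projB_isProj _ _ := qubitProj_isSymmetricProjection _ _

/-! A feasible matrix of the theta program is the Gram matrix of vectors attached to the vertices of
a Möbius ladder with `n = 2N` rungs, together with a unit vector `f`. Put `c = cos(π/n)`, and let
`s_e`, `d_e` be the sum and the difference of the two vectors of rung `e`. Going once around the
ladder, the `s_e` return to themselves and the `d_e` change sign. The orthogonality relations say
`⟨s_e, s_e⟩ = ⟨d_e, d_e⟩ = ⟨f, s_e⟩` and `⟨s_e, s_{e+1}⟩ = ⟨d_e, d_{e+1}⟩`. Antiperiodicity gives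
the discrete Wirtinger inequality `∑ ⟨d_e, d_{e+1}⟩ ≤ c ∑ ‖d_e‖²` (`sum_inner_le_of_antiperiodic`, a
sum of squares). Substituting it into `0 ≤ ∑ ‖s_e + s_{e+1} - (1 + c) f‖²` yields `∑ ‖s_e‖² ≤
(n/2)(1 + c)`, the bound for the theta program (`IsLadderFamily.sum_le`).

At equality `s_e + s_{e+1} = (1 + c) f`, and `d_e` lies on a trigonometric curve spanned by two
vectors. The norms `‖d_e‖ = ‖s_e‖` then depend only on the parity of `e`, which makes the spanning
vectors orthogonal and of equal length; all inner products become explicit (`inner_eq`). This gives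
uniqueness of the maximizer. For projective measurements the objective is `N + I_N / 2`, so the
quantum bound follows as well.

For rank-one projections the vectors of the ladder are nonzero product vectors. The explicit Gram
matrix forces the two vectors of a local setting to be orthogonal, even without completeness, and
two adjacent rungs acquire a normal form in orthonormal pairs (`exists_normal_form`). Matching the
normal forms of two realizations gives local isometries. Two adjacent rungs span the whole extremal
family (`map_eq`), so the isometries carry every vector of the ladder, hence up to phases every
local vector, to its counterpart. -/

/-! ### A trigonometric inequality for antiperiodic sequences of vectors -/

section Wirtinger

variable {H : Type*} [NormedAddCommGroup H] [InnerProductSpace ℝ H]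

/-- The vector whose norm measures the failure of `E` to solve `E (i+1) + E (i-1) = 2 cos t • E i`,
written with the three vectors `E 0`, `E (i+1)`, `E (i+2)`. -/
noncomputable def trigDefect (t : ℝ) (E : ℕ → H) (i : ℕ) : H :=
  Real.sin ((i + 2 : ℕ) * t) • E (i + 1) - Real.sin ((i + 1 : ℕ) * t) • E (i + 2)
    - Real.sin t • E 0

theorem norm_sq_trigDefect (t : ℝ) (E : ℕ → H) (i : ℕ) :
    ‖trigDefect t E i‖ ^ 2 =
      Real.sin ((i + 2 : ℕ) * t) ^ 2 * ‖E (i + 1)‖ ^ 2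
      + Real.sin ((i + 1 : ℕ) * t) ^ 2 * ‖E (i + 2)‖ ^ 2
      + Real.sin t ^ 2 * ‖E 0‖ ^ 2
      - 2 * (Real.sin ((i + 2 : ℕ) * t) * Real.sin ((i + 1 : ℕ) * t) *
        inner ℝ (E (i + 1)) (E (i + 2)))
      - 2 * (Real.sin ((i + 2 : ℕ) * t) * Real.sin t * inner ℝ (E 0) (E (i + 1)))
      + 2 * (Real.sin ((i + 1 : ℕ) * t) * Real.sin t * inner ℝ (E 0) (E (i + 2))) := by
  unfold trigDefect
  simp only [← real_inner_self_eq_norm_sq, inner_sub_left, inner_sub_right, real_inner_smul_left,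
    real_inner_smul_right]
  rw [real_inner_comm (E 0) (E (i + 1)), real_inner_comm (E 0) (E (i + 2)),
    real_inner_comm (E (i + 1)) (E (i + 2))]
  ring

/-- With these weights the products of neighbours all get coefficient `-2`. The two contributions to
an interior `‖E k‖²` add up to `2 cos t` by the recurrence `sin((k+1)t) + sin((k-1)t) = 2 cos t
sin(kt)`, and the terms containing `E 0` telescope. What remains are the boundary terms. -/
theorem sum_trigDefect (t : ℝ) (E : ℕ → H) (m : ℕ)
    (hs : ∀ k ≤ m, Real.sin ((k + 1 : ℕ) * t) ≠ 0) :
    ∑ i ∈ Finset.range m, ‖trigDefect t E i‖ ^ 2 /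
        (Real.sin ((i + 1 : ℕ) * t) * Real.sin ((i + 2 : ℕ) * t)) =
      2 * Real.cos t * ∑ i ∈ Finset.range (m + 1), ‖E i‖ ^ 2
      - 2 * ∑ i ∈ Finset.range (m + 1), inner ℝ (E i) (E (i + 1))
      + Real.sin (m * t) / Real.sin ((m + 1 : ℕ) * t) * ‖E (m + 1)‖ ^ 2
      + 2 * (Real.sin t / Real.sin ((m + 1 : ℕ) * t)) * inner ℝ (E 0) (E (m + 1))
      - Real.sin ((m + 2 : ℕ) * t) / Real.sin ((m + 1 : ℕ) * t) * ‖E 0‖ ^ 2 := by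
  induction m with
  | zero =>
    have h := hs 0 le_rfl
    simp only [zero_add, Nat.cast_one, one_mul] at h
    simp [Real.sin_two_mul]
    field_simp
    ring
  | succ m ih =>
    rw [Finset.sum_range_succ, ih fun k hk => hs k (by omega), norm_sq_trigDefect,
      Finset.sum_range_succ _ (m + 1), Finset.sum_range_succ _ (m + 1)]
    have hu := hs m (by omega)
    have hw := hs (m + 1) le_rfl
    simp only [Nat.add_assoc, Nat.reduceAdd] at hw ⊢
    have e0 : Real.sin (m * t) = 2 * Real.cos t * Real.sin ((m + 1 : ℕ) * t)
        - Real.sin ((m + 2 : ℕ) * t) := by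
      push_cast
      rw [show ((m : ℝ) + 2) * t = (m + 1) * t + t by ring,
        show (m : ℝ) * t = (m + 1) * t - t by ring, Real.sin_add, Real.sin_sub]
      ring
    have e3 : Real.sin ((m + 3 : ℕ) * t) = 2 * Real.cos t * Real.sin ((m + 2 : ℕ) * t)
        - Real.sin ((m + 1 : ℕ) * t) := by
      push_cast
      rw [show ((m : ℝ) + 3) * t = (m + 2) * t + t by ring,
        show ((m : ℝ) + 1) * t = (m + 2) * t - t by ring, Real.sin_add, Real.sin_sub]
      ring
    -- The law of cosines for a triangle with angle `t`; with it the step becomes an identity of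
    -- rational functions in two consecutive sines and `cos t`.
    have es : Real.sin t ^ 2 = Real.sin ((m + 1 : ℕ) * t) ^ 2 + Real.sin ((m + 2 : ℕ) * t) ^ 2
        - 2 * Real.cos t * Real.sin ((m + 1 : ℕ) * t) * Real.sin ((m + 2 : ℕ) * t) := by
      push_cast
      rw [show ((m : ℝ) + 2) * t = (m + 1) * t + t by ring, Real.sin_add]
      have h1 := Real.sin_sq_add_cos_sq t
      have h2 := Real.sin_sq_add_cos_sq (((m : ℝ) + 1) * t)
      linear_combination (-Real.sin t ^ 2) * h2 + Real.sin (((m : ℝ) + 1) * t) ^ 2 * h1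
    rw [e0, e3, es]
    generalize Real.sin ((m + 1 : ℕ) * t) = a at *
    generalize Real.sin ((m + 2 : ℕ) * t) = b at *
    field_simp
    ring

theorem sin_natCast_mul_pi_div_pos {n k : ℕ} (hk : 0 < k) (hkn : k < n) :
    0 < Real.sin (k * (Real.pi / n)) := by
  have hn : (0 : ℝ) < n := by exact_mod_cast hk.trans hkn
  apply Real.sin_pos_of_pos_of_lt_pi
  · have : (0 : ℝ) < k := by exact_mod_cast hk
    positivity
  · rw [mul_div_assoc', div_lt_iff₀ hn, mul_comm]
    exact mul_lt_mul_of_pos_left (by exact_mod_cast hkn) Real.pi_pos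

/-- At `t = π/n` with `n = m + 2` the boundary terms supply exactly the missing last summands:
`sin(nt) = 0`, `sin((n-1)t) = sin t`, `sin((n-2)t) = sin(2t)`, and `E n = -E 0` turns `⟨E 0, E
(n-1)⟩` into the last product of neighbours. -/
theorem sum_trigDefect_antiperiodic (m : ℕ) (E : ℕ → H) (hE : E (m + 2) = -E 0) :
    ∑ i ∈ Finset.range m, ‖trigDefect (Real.pi / (m + 2 : ℕ)) E i‖ ^ 2 /
        (Real.sin ((i + 1 : ℕ) * (Real.pi / (m + 2 : ℕ))) *
          Real.sin ((i + 2 : ℕ) * (Real.pi / (m + 2 : ℕ)))) =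
      2 * (Real.cos (Real.pi / (m + 2 : ℕ)) * ∑ i ∈ Finset.range (m + 2), ‖E i‖ ^ 2
        - ∑ i ∈ Finset.range (m + 2), inner ℝ (E i) (E (i + 1))) := by
  have hpos : ∀ k ≤ m, 0 < Real.sin ((k + 1 : ℕ) * (Real.pi / (m + 2 : ℕ))) := fun k hk =>
    sin_natCast_mul_pi_div_pos (by omega) (by omega)
  rw [sum_trigDefect _ E m fun k hk => (hpos k hk).ne', Finset.sum_range_succ _ (m + 1),
    Finset.sum_range_succ _ (m + 1), hE, inner_neg_right, real_inner_comm]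
  have hm := hpos m le_rfl
  set t := Real.pi / (m + 2 : ℕ) with ht
  have hmt : ((m + 2 : ℕ) : ℝ) * t = Real.pi := by
    rw [ht]; field_simp
  have e1 : Real.sin ((m + 1 : ℕ) * t) = Real.sin t := by
    rw [← Real.sin_pi_sub, ← hmt]; congr 1; push_cast; ring
  have e2 : Real.sin ((m : ℝ) * t) = 2 * Real.sin t * Real.cos t := by
    rw [← Real.sin_two_mul, ← Real.sin_pi_sub, ← hmt]; congr 1; push_cast; ring
  rw [hmt, Real.sin_pi, e1, e2]
  rw [e1] at hm
  field_simp
  ring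

/-- A discrete Wirtinger inequality: for a sequence with `E n = -E 0`. -/
theorem sum_inner_le_of_antiperiodic {n : ℕ} (hn : 2 ≤ n) (E : ℕ → H) (hE : E n = -E 0) :
    ∑ i ∈ Finset.range n, inner ℝ (E i) (E (i + 1)) ≤
      Real.cos (Real.pi / n) * ∑ i ∈ Finset.range n, ‖E i‖ ^ 2 := by
  obtain ⟨m, rfl⟩ := Nat.exists_eq_add_of_le' hn
  have h := sum_trigDefect_antiperiodic m E hE
  have h0 : 0 ≤ ∑ i ∈ Finset.range m, ‖trigDefect (Real.pi / (m + 2 : ℕ)) E i‖ ^ 2 /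
        (Real.sin ((i + 1 : ℕ) * (Real.pi / (m + 2 : ℕ))) *
          Real.sin ((i + 2 : ℕ) * (Real.pi / (m + 2 : ℕ)))) := by
    refine Finset.sum_nonneg fun i hi => div_nonneg (sq_nonneg _) (mul_nonneg ?_ ?_)
    all_goals
      have := Finset.mem_range.1 hi
      exact (sin_natCast_mul_pi_div_pos (by omega) (by omega)).le
  linarith

/-- In the equality case of `sum_inner_le_of_antiperiodic` the sequence is trigonometric. -/
theorem eq_trig_of_sum_inner_eq {n : ℕ} (hn : 2 ≤ n) (E : ℕ → H) (hE : E n = -E 0)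
    (h : ∑ i ∈ Finset.range n, inner ℝ (E i) (E (i + 1)) =
      Real.cos (Real.pi / n) * ∑ i ∈ Finset.range n, ‖E i‖ ^ 2) {i : ℕ} (hi : i < n) :
    E i = Real.cos (i * (Real.pi / n)) • E 0 + Real.sin (i * (Real.pi / n)) •
      ((Real.sin (Real.pi / n))⁻¹ • (E 1 - Real.cos (Real.pi / n) • E 0)) := by
  obtain ⟨m, rfl⟩ := Nat.exists_eq_add_of_le' hn
  have h' := sum_trigDefect_antiperiodic m E hE
  -- The weights are positive, so equality makes every defect vanish; this expresses `E (j+2)`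
  -- through `E 0` and `E (j+1)`.
  rw [h, sub_self, mul_zero, Finset.sum_eq_zero_iff_of_nonneg] at h'
  swap
  · refine fun i hi => div_nonneg (sq_nonneg _) (mul_nonneg ?_ ?_)
    all_goals
      have := Finset.mem_range.1 hi
      exact (sin_natCast_mul_pi_div_pos (by omega) (by omega)).le
  have hpos : ∀ k ≤ m, 0 < Real.sin ((k + 1 : ℕ) * (Real.pi / (m + 2 : ℕ))) := fun k hk =>
    sin_natCast_mul_pi_div_pos (by omega) (by omega)
  set t := Real.pi / (m + 2 : ℕ) with ht
  have ht0 : Real.sin t ≠ 0 := by simpa using (hpos 0 (by omega)).ne'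
  induction i with
  | zero => simp
  | succ i ih =>
    rcases Nat.eq_zero_or_pos i with rfl | hi0
    · simp [smul_smul, ht0]
    obtain ⟨j, rfl⟩ := Nat.exists_eq_add_of_le' hi0
    have hj := h' j (Finset.mem_range.2 (by omega))
    have h1 := hpos j (by omega)
    have h2 := hpos (j + 1) (by omega)
    rw [Nat.add_assoc] at h2
    rw [div_eq_zero_iff, or_iff_left (mul_pos h1 h2).ne', sq_eq_zero_iff, norm_eq_zero,
      trigDefect, sub_sub, sub_eq_zero] at hj
    have hE2 : E (j + 2) = (Real.sin ((j + 1 : ℕ) * t))⁻¹ •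
        (Real.sin ((j + 2 : ℕ) * t) • E (j + 1) - Real.sin t • E 0) := by
      rw [hj, add_sub_cancel_right, smul_smul, inv_mul_cancel₀ h1.ne', one_smul]
    rw [Nat.add_assoc, hE2, ih (by omega)]
    have e1 : Real.sin ((j + 2 : ℕ) * t) * Real.cos ((j + 1 : ℕ) * t) - Real.sin t =
        Real.sin ((j + 1 : ℕ) * t) * Real.cos ((j + 2 : ℕ) * t) := by
      rw [show Real.sin t = Real.sin ((j + 2 : ℕ) * t - (j + 1 : ℕ) * t) by
        congr 1; push_cast; ring, Real.sin_sub]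
      ring
    simp only [Nat.succ_eq_add_one, zero_add, Nat.reduceAdd]
    generalize (Real.sin t)⁻¹ • (E 1 - Real.cos t • E 0) = w
    generalize Real.sin ((j + 1 : ℕ) * t) = a at *
    generalize Real.sin ((j + 2 : ℕ) * t) = b at *
    generalize Real.cos ((j + 1 : ℕ) * t) = d at *
    generalize Real.cos ((j + 2 : ℕ) * t) = e at *
    have h1' := h1.ne'
    rw [smul_add, smul_smul, smul_smul, add_sub_right_comm, ← sub_smul, e1, smul_add, smul_smul,
      smul_smul, mul_comm b a, inv_mul_cancel_left₀ h1', inv_mul_cancel_left₀ h1']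

end Wirtinger

/-! ### Vector solutions of the theta program of a Möbius ladder -/

section Ladder

variable {H : Type*} [NormedAddCommGroup H] [InnerProductSpace ℂ H]

attribute [local instance] InnerProductSpace.complexToReal

/-- Vectors feasible for the theta program of the Möbius ladder with `n` rungs (`n` even), written
with the rungs numbered by `e : ℕ` and the two ends of a rung by a sign; going once around the
ladder exchanges the ends. -/
structure IsLadderFamily (n : ℕ) (f : H) (v : ℕ → ℤˣ → H) : Prop where
  norm_base : ‖f‖ = 1
  shift : ∀ e b, v (e + n) b = v e (-b)
  diag : ∀ e b, inner ℂ (v e b) (v e b) = inner ℂ f (v e b)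
  rung : ∀ e, inner ℂ (v e 1) (v e (-1)) = 0
  link : ∀ e b, inner ℂ (v e b) (v (e + 1) (-b)) = 0

/-- The sum of the vectors at the two ends of a rung. -/
def ladderSum (v : ℕ → ℤˣ → H) (e : ℕ) : H := v e 1 + v e (-1)

/-- The difference of the vectors at the two ends of a rung. -/
def ladderDiff (v : ℕ → ℤˣ → H) (e : ℕ) : H := v e 1 - v e (-1)

theorem eq_ladderSum_add_ladderDiff (v : ℕ → ℤˣ → H) (e : ℕ) (b : ℤˣ) :
    v e b = (1 / 2 : ℂ) • (ladderSum v e + ((b : ℤ) : ℂ) • ladderDiff v e) := by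
  rcases Int.units_eq_one_or b with rfl | rfl <;> simp only [ladderSum, ladderDiff] <;>
    push_cast <;> module

namespace IsLadderFamily

variable {n : ℕ} {f : H} {v : ℕ → ℤˣ → H}

theorem inner_base (h : IsLadderFamily n f v) : inner ℂ f f = 1 := by
  rw [inner_self_eq_norm_sq_to_K, h.norm_base]; simp

theorem rung' (h : IsLadderFamily n f v) (e : ℕ) : inner ℂ (v e (-1)) (v e 1) = 0 := by
  rw [← inner_conj_symm, h.rung, map_zero]

theorem sum_shift (h : IsLadderFamily n f v) (e : ℕ) : ladderSum v (e + n) = ladderSum v e := by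
  simp only [ladderSum, h.shift, neg_neg]; abel

theorem diff_shift (h : IsLadderFamily n f v) (e : ℕ) :
    ladderDiff v (e + n) = -ladderDiff v e := by
  simp only [ladderDiff, h.shift, neg_neg]; abel

theorem inner_sum_self (h : IsLadderFamily n f v) (e : ℕ) :
    inner ℂ (ladderSum v e) (ladderSum v e) = inner ℂ f (ladderSum v e) := by
  simp only [ladderSum, inner_add_left, inner_add_right, h.rung, h.rung', h.diag]; ring

theorem inner_diff_self (h : IsLadderFamily n f v) (e : ℕ) :
    inner ℂ (ladderDiff v e) (ladderDiff v e) = inner ℂ f (ladderSum v e) := by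
  simp only [ladderSum, ladderDiff, inner_sub_left, inner_sub_right, inner_add_right, h.rung,
    h.rung', h.diag]
  ring

theorem inner_sum_diff (h : IsLadderFamily n f v) (e : ℕ) :
    inner ℂ (ladderSum v e) (ladderDiff v e) = inner ℂ f (ladderDiff v e) := by
  simp only [ladderSum, ladderDiff, inner_add_left, inner_sub_right, h.rung, h.rung', h.diag]
  ring

/-- The two sides differ by twice the sum of the products of opposite ends of adjacent rungs, which
`link` makes zero. -/
theorem inner_sum_succ (h : IsLadderFamily n f v) (e : ℕ) :
    inner ℂ (ladderSum v e) (ladderSum v (e + 1)) =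
      inner ℂ (ladderDiff v e) (ladderDiff v (e + 1)) := by
  have h1 := h.link e 1
  have h2 := h.link e (-1)
  rw [neg_neg] at h2
  simp only [ladderSum, ladderDiff, inner_add_left, inner_sub_left, inner_add_right,
    inner_sub_right, h1, h2]
  ring

theorem norm_sum_sq (h : IsLadderFamily n f v) (e : ℕ) :
    ‖ladderSum v e‖ ^ 2 = (inner ℂ f (ladderSum v e)).re := by
  rw [← h.inner_sum_self, ← inner_self_eq_norm_sq (𝕜 := ℂ)]; rfl

theorem norm_diff_sq (h : IsLadderFamily n f v) (e : ℕ) :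
    ‖ladderDiff v e‖ ^ 2 = ‖ladderSum v e‖ ^ 2 := by
  rw [h.norm_sum_sq, ← h.inner_diff_self, ← inner_self_eq_norm_sq (𝕜 := ℂ)]; rfl

/-- Both `⟨f, s_e⟩ = ‖s_e‖²` and `inner_sum_succ` enter, so that an estimate for the differences
alone controls the sums. -/
theorem norm_sum_add_sum_sub (h : IsLadderFamily n f v) (e : ℕ) (r : ℝ) :
    ‖ladderSum v e + ladderSum v (e + 1) - r • f‖ ^ 2 =
      (1 - 2 * r) * (‖ladderSum v e‖ ^ 2 + ‖ladderSum v (e + 1)‖ ^ 2) +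
        2 * inner ℝ (ladderDiff v e) (ladderDiff v (e + 1)) + r ^ 2 := by
  have h1 : inner ℝ (ladderSum v e) (ladderSum v (e + 1)) =
      inner ℝ (ladderDiff v e) (ladderDiff v (e + 1)) := by
    rw [real_inner_eq_re_inner ℂ, real_inner_eq_re_inner ℂ, h.inner_sum_succ]
  have h2 : ∀ e, inner ℝ f (ladderSum v e) = ‖ladderSum v e‖ ^ 2 := fun e => by
    rw [real_inner_eq_re_inner ℂ, h.norm_sum_sq]; rfl
  rw [norm_sub_sq_real, norm_add_sq_real, norm_smul, h.norm_base, real_inner_smul_right,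
    real_inner_comm f, inner_add_right, h2, h2, h1, mul_one, Real.norm_eq_abs, sq_abs]
  ring

theorem sum_norm_sum_add_sum_sub (h : IsLadderFamily n f v) (r : ℝ) :
    ∑ e ∈ Finset.range n, ‖ladderSum v e + ladderSum v (e + 1) - r • f‖ ^ 2 =
      2 * (1 - 2 * r) * ∑ e ∈ Finset.range n, ‖ladderSum v e‖ ^ 2 +
        2 * ∑ e ∈ Finset.range n, inner ℝ (ladderDiff v e) (ladderDiff v (e + 1)) + n * r ^ 2 := by
  have h1 : ∑ e ∈ Finset.range n, ‖ladderSum v (e + 1)‖ ^ 2 =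
      ∑ e ∈ Finset.range n, ‖ladderSum v e‖ ^ 2 := by
    have h2 := Finset.sum_range_succ (fun e => ‖ladderSum v e‖ ^ 2) n
    have h3 := Finset.sum_range_succ' (fun e => ‖ladderSum v e‖ ^ 2) n
    have h4 := h.sum_shift 0
    rw [zero_add] at h4
    rw [h3, h4] at h2
    exact add_right_cancel h2
  simp only [h.norm_sum_add_sum_sub, Finset.sum_add_distrib, ← Finset.mul_sum, h1,
    Finset.sum_const, Finset.card_range, nsmul_eq_mul]
  ring

theorem one_add_cos_pos (hn : 2 ≤ n) : 0 < 1 + Real.cos (Real.pi / n) := by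
  have h2 : (2 : ℝ) ≤ n := by exact_mod_cast hn
  have : 0 ≤ Real.cos (Real.pi / n) := Real.cos_nonneg_of_neg_pi_div_two_le_of_le
    (by have := Real.pi_pos; have : 0 < Real.pi / n := by positivity
        linarith) (div_le_div_of_nonneg_left Real.pi_pos.le (by norm_num) h2)
  linarith

theorem sum_inner_diff_le (h : IsLadderFamily n f v) (hn : 2 ≤ n) :
    ∑ e ∈ Finset.range n, inner ℝ (ladderDiff v e) (ladderDiff v (e + 1)) ≤
      Real.cos (Real.pi / n) * ∑ e ∈ Finset.range n, ‖ladderSum v e‖ ^ 2 := by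
  have := sum_inner_le_of_antiperiodic hn (ladderDiff v) (by simpa using h.diff_shift 0)
  simpa only [h.norm_diff_sq] using this

/-- The upper bound for the theta program of the Möbius ladder. -/
theorem sum_le (h : IsLadderFamily n f v) (hn : 2 ≤ n) :
    ∑ e ∈ Finset.range n, ‖ladderSum v e‖ ^ 2 ≤ n / 2 * (1 + Real.cos (Real.pi / n)) := by
  -- Among all `r`, the choice `1 + cos(π/n)` gives the smallest resulting bound.
  have h1 := h.sum_norm_sum_add_sum_sub (1 + Real.cos (Real.pi / n))
  have h2 := h.sum_inner_diff_le hn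
  have h3 : 0 ≤ ∑ e ∈ Finset.range n, ‖ladderSum v e + ladderSum v (e + 1) -
      (1 + Real.cos (Real.pi / n)) • f‖ ^ 2 := Finset.sum_nonneg fun _ _ => sq_nonneg _
  have h4 := one_add_cos_pos hn
  rw [h1] at h3
  refine le_of_mul_le_mul_left (a := 2 * (1 + Real.cos (Real.pi / n))) ?_ (by positivity)
  linear_combination h3 + 2 * h2

/-- `IsLadderFamily` together with equality in the upper bound. -/
structure IsExtremal (n : ℕ) (f : H) (v : ℕ → ℤˣ → H) : Prop extends IsLadderFamily n f v where
  sum_eq : ∑ e ∈ Finset.range n, ‖ladderSum v e‖ ^ 2 = n / 2 * (1 + Real.cos (Real.pi / n))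

end IsLadderFamily

/-! ### The equality case of the ladder bound -/

namespace IsLadderFamily.IsExtremal

variable {n : ℕ} {f : H} {v : ℕ → ℤˣ → H}

theorem sum_inner_diff_eq (h : IsExtremal n f v) (hn : 2 ≤ n) :
    ∑ e ∈ Finset.range n, inner ℝ (ladderDiff v e) (ladderDiff v (e + 1)) =
      Real.cos (Real.pi / n) * ∑ e ∈ Finset.range n, ‖ladderSum v e‖ ^ 2 := by
  refine le_antisymm (h.sum_inner_diff_le hn) ?_
  have h1 := h.sum_norm_sum_add_sum_sub (1 + Real.cos (Real.pi / n))
  have h3 : 0 ≤ ∑ e ∈ Finset.range n, ‖ladderSum v e + ladderSum v (e + 1) -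
      (1 + Real.cos (Real.pi / n)) • f‖ ^ 2 := Finset.sum_nonneg fun _ _ => sq_nonneg _
  rw [h1] at h3
  rw [h.sum_eq] at h3 ⊢
  linear_combination h3 / 2

theorem sum_add_sum_succ (h : IsExtremal n f v) (hn : 2 ≤ n) (e : ℕ) :
    ladderSum v e + ladderSum v (e + 1) = (1 + Real.cos (Real.pi / n)) • f := by
  have h1 := h.sum_norm_sum_add_sum_sub (1 + Real.cos (Real.pi / n))
  rw [h.sum_inner_diff_eq hn, h.sum_eq] at h1
  replace h1 := h1.trans (b := _) (c := 0) (by ring)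
  rw [Finset.sum_eq_zero_iff_of_nonneg fun _ _ => sq_nonneg _] at h1
  have h2 : ∀ e < n, ladderSum v e + ladderSum v (e + 1) =
      (1 + Real.cos (Real.pi / n)) • f := fun e he => by
    simpa [sub_eq_zero] using h1 e (Finset.mem_range.2 he)
  -- The vanishing squares cover only one turn around the ladder; periodicity of the sums gives all
  -- `e`.
  have h3 : ∀ q r, ladderSum v (r + q * n) = ladderSum v r := fun q r => by
    induction q with
    | zero => simp
    | succ q ih => rw [Nat.succ_mul, ← add_assoc, h.sum_shift, ih]
  have h4 := h3 (e / n) (e % n)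
  have h5 := h3 (e / n) (e % n + 1)
  rw [Nat.mod_add_div'] at h4
  rw [add_right_comm, Nat.mod_add_div'] at h5
  rw [h4, h5]
  exact h2 _ (Nat.mod_lt _ (by omega))

/-- The component of the differences orthogonal to the first one. -/
noncomputable def quarter (n : ℕ) (v : ℕ → ℤˣ → H) : H :=
  ((Real.sin (Real.pi / n))⁻¹ : ℝ) •
    (ladderDiff v 1 - Real.cos (Real.pi / n) • ladderDiff v 0)

theorem diff_eq (h : IsExtremal n f v) (hn : 2 ≤ n) (e : ℕ) :
    ladderDiff v e = Real.cos (e * (Real.pi / n)) • ladderDiff v 0 +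
      Real.sin (e * (Real.pi / n)) • quarter n v := by
  have h1 : ∀ q r, r < n → ladderDiff v (r + q * n) =
      Real.cos ((r + q * n : ℕ) * (Real.pi / n)) • ladderDiff v 0 +
      Real.sin ((r + q * n : ℕ) * (Real.pi / n)) • quarter n v := fun q r hr => by
    induction q with
    | zero =>
      rw [Nat.zero_mul, add_zero]
      refine eq_trig_of_sum_inner_eq hn (ladderDiff v) (by simpa using h.diff_shift 0) ?_ hr
      simpa only [h.norm_diff_sq] using h.sum_inner_diff_eq hn
    | succ q ih =>
      have hn0 : (n : ℝ) ≠ 0 := by positivity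
      have e1 : ((r + (q + 1) * n : ℕ) : ℝ) * (Real.pi / n) =
          (r + q * n : ℕ) * (Real.pi / n) + Real.pi := by
        push_cast; field_simp; ring
      rw [e1, Real.cos_add_pi, Real.sin_add_pi, Nat.succ_mul, ← add_assoc, h.diff_shift, ih]
      module
  have := h1 (e / n) (e % n) (Nat.mod_lt _ (by omega))
  rwa [Nat.mod_add_div'] at this

end IsLadderFamily.IsExtremal

end Ladder

/-! ### Rigidity of extremal families: all inner products -/

section ExtremalGram

variable {H : Type*} [NormedAddCommGroup H] [InnerProductSpace ℂ H]

attribute [local instance] InnerProductSpace.complexToReal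

namespace IsLadderFamily.IsExtremal

variable {n : ℕ} {f : H} {v : ℕ → ℤˣ → H}

theorem sum_succ (h : IsExtremal n f v) (hn : 2 ≤ n) (e : ℕ) :
    ladderSum v (e + 1) = ((1 + Real.cos (Real.pi / n) : ℝ) : ℂ) • f - ladderSum v e := by
  rw [Complex.coe_smul, ← h.sum_add_sum_succ hn e, add_sub_cancel_left]

theorem sum_add_two (h : IsExtremal n f v) (hn : 2 ≤ n) (e : ℕ) :
    ladderSum v (e + 2) = ladderSum v e := by
  rw [h.sum_succ hn, h.sum_succ hn, sub_sub_cancel]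

theorem sum_add_even (h : IsExtremal n f v) (hn : 2 ≤ n) (e k : ℕ) :
    ladderSum v (e + 2 * k) = ladderSum v e := by
  induction k with
  | zero => rfl
  | succ k ih => rw [mul_add, ← add_assoc, h.sum_add_two hn, ih]

theorem diff_eq' (h : IsExtremal n f v) (hn : 2 ≤ n) (e : ℕ) :
    ladderDiff v e = (Real.cos (e * (Real.pi / n)) : ℂ) • ladderDiff v 0 +
      (Real.sin (e * (Real.pi / n)) : ℂ) • quarter n v := by
  rw [h.diff_eq hn, Complex.coe_smul, Complex.coe_smul]

/-- The left side equals `‖ladderSum v e‖ ^ 2` and hence depends only on the parity of `e`;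
comparing indices of equal parity yields the relations between `ladderDiff v 0` and `quarter n v`.
-/
theorem norm_diff_sq_eq (h : IsExtremal n f v) (hn : 2 ≤ n) (e : ℕ) :
    ‖ladderDiff v e‖ ^ 2 = Real.cos (e * (Real.pi / n)) ^ 2 * ‖ladderDiff v 0‖ ^ 2
      + Real.sin (e * (Real.pi / n)) ^ 2 * ‖quarter n v‖ ^ 2
      + 2 * (Real.cos (e * (Real.pi / n)) * Real.sin (e * (Real.pi / n)) *
        inner ℝ (ladderDiff v 0) (quarter n v)) := by
  conv_lhs => rw [h.diff_eq hn, norm_add_sq_real, norm_smul, norm_smul, real_inner_smul_left,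
    real_inner_smul_right, mul_pow, mul_pow, Real.norm_eq_abs, Real.norm_eq_abs, sq_abs, sq_abs]
  ring

theorem sin_pi_div_pos (hn : 2 ≤ n) : 0 < Real.sin (Real.pi / n) := by
  simpa using sin_natCast_mul_pi_div_pos (n := n) one_pos (by omega)

theorem cos_pi_div_pos (hn : 4 ≤ n) : 0 < Real.cos (Real.pi / n) := by
  have h2 := sin_natCast_mul_pi_div_pos (n := n) two_pos (by omega)
  have h1 := sin_pi_div_pos (n := n) (by omega)
  rw [Nat.cast_ofNat, Real.sin_two_mul] at h2
  exact pos_of_mul_pos_right h2 (by positivity)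

theorem cos_pi_div_lt_one (hn : 4 ≤ n) : Real.cos (Real.pi / n) < 1 := by
  have h1 := sin_pi_div_pos (n := n) (by omega)
  have h2 := Real.sin_sq_add_cos_sq (Real.pi / n)
  nlinarith [sq_nonneg (Real.cos (Real.pi / n) - 1)]

/-- Since `n` is even, `1` and `n - 1` have the same parity, while the cross terms of
`norm_diff_sq_eq` at these indices have opposite signs. -/
theorem re_inner_quarter (h : IsExtremal n f v) (hn : 4 ≤ n) (hev : Even n) :
    inner ℝ (ladderDiff v 0) (quarter n v) = 0 := by
  obtain ⟨k, hk⟩ := hev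
  have h1 := h.norm_diff_sq_eq (by omega) 1
  have h2 := h.norm_diff_sq_eq (by omega) (1 + 2 * (k - 1))
  rw [h.norm_diff_sq, h.sum_add_even (by omega), ← h.norm_diff_sq, h1] at h2
  have e1 : ((1 + 2 * (k - 1) : ℕ) : ℝ) * (Real.pi / n) = Real.pi - Real.pi / n := by
    rw [show 1 + 2 * (k - 1) = n - 1 by omega, Nat.cast_sub (by omega)]
    have : (n : ℝ) ≠ 0 := by positivity
    field_simp
    simp
  rw [e1, Nat.cast_one, one_mul, Real.cos_pi_sub, Real.sin_pi_sub] at h2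
  have hs := sin_pi_div_pos (n := n) (by omega)
  have hc := cos_pi_div_pos hn
  have h3 : (Real.cos (Real.pi / n) * Real.sin (Real.pi / n)) *
      inner ℝ (ladderDiff v 0) (quarter n v) = 0 := by linear_combination h2 / 4
  exact (mul_eq_zero.1 h3).resolve_left (mul_pos hc hs).ne'

/-- Indices `0` and `2` are compared; `n ≥ 4` ensures `sin(2π/n) ≠ 0`. -/
theorem norm_quarter_sq (h : IsExtremal n f v) (hn : 4 ≤ n) (hev : Even n) :
    ‖quarter n v‖ ^ 2 = ‖ladderDiff v 0‖ ^ 2 := by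
  have h2 := h.norm_diff_sq_eq (by omega) 2
  rw [h.norm_diff_sq, h.sum_add_two (by omega) 0, ← h.norm_diff_sq,
    h.re_inner_quarter hn hev] at h2
  have hs := sin_natCast_mul_pi_div_pos (n := n) two_pos (by omega)
  have h3 := Real.sin_sq_add_cos_sq ((2 : ℕ) * (Real.pi / n))
  have h4 : Real.sin ((2 : ℕ) * (Real.pi / n)) ^ 2 * ‖quarter n v‖ ^ 2 =
      Real.sin ((2 : ℕ) * (Real.pi / n)) ^ 2 * ‖ladderDiff v 0‖ ^ 2 := by
    linear_combination -h2 - ‖ladderDiff v 0‖ ^ 2 * h3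
  exact mul_left_cancel₀ (by positivity) h4

theorem norm_sum_sq_eq (h : IsExtremal n f v) (hn : 4 ≤ n) (hev : Even n) (e : ℕ) :
    ‖ladderSum v e‖ ^ 2 = (1 + Real.cos (Real.pi / n)) / 2 := by
  have h1 : ∀ e, ‖ladderSum v e‖ ^ 2 = ‖ladderDiff v 0‖ ^ 2 := fun e => by
    rw [← h.norm_diff_sq, h.norm_diff_sq_eq (by omega), h.norm_quarter_sq hn hev,
      h.re_inner_quarter hn hev]
    have := Real.sin_sq_add_cos_sq (e * (Real.pi / n))
    linear_combination ‖ladderDiff v 0‖ ^ 2 * this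
  -- The common norm is fixed by pairing `s_0 + s_1 = (1 + c) f` with `f`.
  have h2 : ‖ladderSum v 0‖ ^ 2 + ‖ladderSum v 1‖ ^ 2 = 1 + Real.cos (Real.pi / n) := by
    rw [h.norm_sum_sq, h.norm_sum_sq, ← Complex.add_re, ← inner_add_right,
      h.sum_succ (by omega) 0, add_sub_cancel, inner_smul_right, h.inner_base, mul_one,
      Complex.ofReal_re]
  rw [h1] at h2 ⊢
  rw [h1] at h2
  linarith

theorem inner_sum_self_eq (h : IsExtremal n f v) (hn : 4 ≤ n) (hev : Even n) (e : ℕ) :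
    inner ℂ (ladderSum v e) (ladderSum v e) = (((1 + Real.cos (Real.pi / n)) / 2 : ℝ) : ℂ) := by
  rw [inner_self_eq_norm_sq_to_K, ← h.norm_sum_sq_eq hn hev e]
  simp

theorem inner_base_sum (h : IsExtremal n f v) (hn : 4 ≤ n) (hev : Even n) (e : ℕ) :
    inner ℂ f (ladderSum v e) = (((1 + Real.cos (Real.pi / n)) / 2 : ℝ) : ℂ) := by
  rw [← h.inner_sum_self, h.inner_sum_self_eq hn hev]

theorem inner_sum_base (h : IsExtremal n f v) (hn : 4 ≤ n) (hev : Even n) (e : ℕ) :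
    inner ℂ (ladderSum v e) f = (((1 + Real.cos (Real.pi / n)) / 2 : ℝ) : ℂ) := by
  rw [← inner_conj_symm, h.inner_base_sum hn hev, Complex.conj_ofReal]

theorem inner_sum_succ_eq (h : IsExtremal n f v) (hn : 4 ≤ n) (hev : Even n) (e : ℕ) :
    inner ℂ (ladderSum v e) (ladderSum v (e + 1)) =
      (((1 + Real.cos (Real.pi / n)) / 2 * Real.cos (Real.pi / n) : ℝ) : ℂ) := by
  rw [h.sum_succ (by omega), inner_sub_right, inner_smul_right, h.inner_sum_base hn hev,
    h.inner_sum_self_eq hn hev]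
  push_cast
  ring

/-- The relation `⟨s_e, d_e⟩ = ⟨f, d_e⟩` is written at `e` and `e + 2`, where the sums agree. This
is a linear system for the two unknown products, with determinant `sin(2π/n) ≠ 0`. -/
theorem inner_sum_diff_zero_and_quarter (h : IsExtremal n f v) (hn : 4 ≤ n) (e : ℕ) :
    inner ℂ (ladderSum v e) (ladderDiff v 0) = inner ℂ f (ladderDiff v 0) ∧
    inner ℂ (ladderSum v e) (quarter n v) = inner ℂ f (quarter n v) := by
  have h1 := h.inner_sum_diff e
  have h2 := h.inner_sum_diff (e + 2)
  rw [h.sum_add_two (by omega)] at h2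
  rw [h.diff_eq' (by omega) e] at h1
  rw [h.diff_eq' (by omega) (e + 2)] at h2
  simp only [inner_add_right, inner_smul_right] at h1 h2
  have hs := (sin_natCast_mul_pi_div_pos (n := n) two_pos (by omega)).ne'
  have e1 : Real.sin ((2 : ℕ) * (Real.pi / n)) =
      Real.sin ((e + 2 : ℕ) * (Real.pi / n)) * Real.cos (e * (Real.pi / n)) -
      Real.cos ((e + 2 : ℕ) * (Real.pi / n)) * Real.sin (e * (Real.pi / n)) := by
    rw [← Real.sin_sub]; congr 1; push_cast; ring
  have e2 : (Real.sin ((2 : ℕ) * (Real.pi / n)) : ℂ) =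
      Real.sin ((e + 2 : ℕ) * (Real.pi / n)) * Real.cos (e * (Real.pi / n)) -
      Real.cos ((e + 2 : ℕ) * (Real.pi / n)) * Real.sin (e * (Real.pi / n)) := by
    rw [e1]; push_cast; ring
  have hs' : (Real.sin ((2 : ℕ) * (Real.pi / n)) : ℂ) ≠ 0 := Complex.ofReal_ne_zero.2 hs
  constructor
  · apply mul_left_cancel₀ hs'
    rw [e2]
    linear_combination (Real.sin ((e + 2 : ℕ) * (Real.pi / n)) : ℂ) * h1 -
      (Real.sin (e * (Real.pi / n)) : ℂ) * h2
  · apply mul_left_cancel₀ hs'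
    rw [e2]
    linear_combination -(Real.cos ((e + 2 : ℕ) * (Real.pi / n)) : ℂ) * h1 +
      (Real.cos (e * (Real.pi / n)) : ℂ) * h2

/-- Adding the hypothesis for two consecutive rungs gives `(1 + c) ⟨f, w⟩ = 2 ⟨f, w⟩`, and `c < 1`.
-/
theorem inner_base_eq_zero_of_forall (h : IsExtremal n f v) (hn : 4 ≤ n) {w : H}
    (hw : ∀ e, inner ℂ (ladderSum v e) w = inner ℂ f w) :
    inner ℂ f w = 0 := by
  have h0 := hw 1
  rw [h.sum_succ (by omega), inner_sub_left, hw 0, inner_smul_left, Complex.conj_ofReal] at h0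
  have hc := cos_pi_div_lt_one hn
  have hne : ((1 - Real.cos (Real.pi / n) : ℝ) : ℂ) ≠ 0 :=
    Complex.ofReal_ne_zero.2 (by linarith)
  apply (mul_eq_zero.1 (?_ : ((1 - Real.cos (Real.pi / n) : ℝ) : ℂ) * inner ℂ f w = 0)).resolve_left
    hne
  push_cast at h0 ⊢
  linear_combination -h0

theorem inner_sum_diff_eq_zero (h : IsExtremal n f v) (hn : 4 ≤ n) (e e' : ℕ) :
    inner ℂ (ladderSum v e) (ladderDiff v e') = 0 := by
  have h1 := fun e => (h.inner_sum_diff_zero_and_quarter hn e).1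
  have h2 := fun e => (h.inner_sum_diff_zero_and_quarter hn e).2
  rw [h.diff_eq' (by omega) e', inner_add_right, inner_smul_right, inner_smul_right, h1, h2,
    h.inner_base_eq_zero_of_forall hn h1, h.inner_base_eq_zero_of_forall hn h2]
  simp

theorem inner_diff_sum_eq_zero (h : IsExtremal n f v) (hn : 4 ≤ n) (e e' : ℕ) :
    inner ℂ (ladderDiff v e) (ladderSum v e') = 0 := by
  rw [← inner_conj_symm, h.inner_sum_diff_eq_zero hn, map_zero]

/-- `re_inner_quarter` only treats the real part. The complex statement comes from `⟨s_0, s_1⟩ =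
⟨d_0, d_1⟩`, both sides of which have the same known part. -/
theorem inner_quarter (h : IsExtremal n f v) (hn : 4 ≤ n) (hev : Even n) :
    inner ℂ (ladderDiff v 0) (quarter n v) = 0 := by
  have h1 := h.inner_sum_succ 0
  rw [h.inner_sum_succ_eq hn hev, h.diff_eq' (by omega) (0 + 1), inner_add_right,
    inner_smul_right, inner_smul_right, h.inner_diff_self, h.inner_base_sum hn hev] at h1
  have hs : (Real.sin (Real.pi / n) : ℂ) ≠ 0 :=
    Complex.ofReal_ne_zero.2 (sin_pi_div_pos (by omega)).ne'
  simp only [zero_add, Nat.cast_one, one_mul] at h1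
  refine (mul_eq_zero.1 (?_ : (Real.sin (Real.pi / n) : ℂ) * _ = 0)).resolve_left hs
  push_cast at h1 ⊢
  linear_combination -h1

theorem inner_diff_diff (h : IsExtremal n f v) (hn : 4 ≤ n) (hev : Even n) (e e' : ℕ) :
    inner ℂ (ladderDiff v e) (ladderDiff v e') =
      (((1 + Real.cos (Real.pi / n)) / 2 *
        Real.cos ((e : ℝ) * (Real.pi / n) - e' * (Real.pi / n)) : ℝ) : ℂ) := by
  have h1 : inner ℂ (quarter n v) (quarter n v) =
      (((1 + Real.cos (Real.pi / n)) / 2 : ℝ) : ℂ) := by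
    rw [← h.norm_sum_sq_eq hn hev 0, ← h.norm_diff_sq, ← h.norm_quarter_sq hn hev,
      inner_self_eq_norm_sq_to_K]
    simp
  have h2 : inner ℂ (quarter n v) (ladderDiff v 0) = 0 := by
    rw [← inner_conj_symm, h.inner_quarter hn hev, map_zero]
  rw [h.diff_eq' (by omega) e, h.diff_eq' (by omega) e', Real.cos_sub]
  simp only [inner_add_left, inner_add_right, inner_smul_left, inner_smul_right, h1, h2,
    h.inner_quarter hn hev, h.inner_diff_self, h.inner_base_sum hn hev, Complex.conj_ofReal]
  push_cast
  ring

theorem inner_sum_sum (h : IsExtremal n f v) (hn : 4 ≤ n) (hev : Even n) (e e' : ℕ) :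
    inner ℂ (ladderSum v e) (ladderSum v e') =
      (((1 + Real.cos (Real.pi / n)) / 2 *
        (if e % 2 = e' % 2 then 1 else Real.cos (Real.pi / n)) : ℝ) : ℂ) := by
  have h1 : ∀ e, ladderSum v e = ladderSum v (e % 2) := fun e => by
    conv_lhs => rw [← Nat.mod_add_div e 2, h.sum_add_even (by omega)]
  rw [h1 e, h1 e']
  have h2 := h.inner_sum_succ_eq hn hev 0
  have h3 : inner ℂ (ladderSum v 1) (ladderSum v 0) =
      (((1 + Real.cos (Real.pi / n)) / 2 * Real.cos (Real.pi / n) : ℝ) : ℂ) := by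
    rw [← inner_conj_symm, h2, Complex.conj_ofReal]
  rcases Nat.mod_two_eq_zero_or_one e with he | he <;>
    rcases Nat.mod_two_eq_zero_or_one e' with he' | he' <;> rw [he, he'] <;>
    simp [h2, h3, h.inner_sum_self_eq hn hev, -inner_self_eq_norm_sq_to_K]

/-- The Gram matrix of an extremal family is explicit. -/
theorem inner_eq (h : IsExtremal n f v) (hn : 4 ≤ n) (hev : Even n) (e e' : ℕ) (b b' : ℤˣ) :
    inner ℂ (v e b) (v e' b') =
      (((1 + Real.cos (Real.pi / n)) / 8 *
        ((if e % 2 = e' % 2 then 1 else Real.cos (Real.pi / n)) + ((b * b' : ℤˣ) : ℤ) *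
          Real.cos ((e : ℝ) * (Real.pi / n) - e' * (Real.pi / n))) : ℝ) : ℂ) := by
  rw [eq_ladderSum_add_ladderDiff v e, eq_ladderSum_add_ladderDiff v e']
  simp only [inner_add_left, inner_add_right, inner_smul_left, inner_smul_right,
    h.inner_diff_diff hn hev, h.inner_sum_sum hn hev, h.inner_sum_diff_eq_zero hn,
    h.inner_diff_sum_eq_zero hn, map_div₀, map_one, map_ofNat, map_intCast]
  push_cast
  ring

end IsLadderFamily.IsExtremal

end ExtremalGram

/-! ### The exclusivity graph is a Möbius ladder -/

section MobiusLadder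

theorem units_neg_one_pow_eq_iff (m m' : ℕ) : (-1 : ℤˣ) ^ m = (-1) ^ m' ↔ m % 2 = m' % 2 := by
  rw [Int.units_pow_eq_pow_mod_two, Int.units_pow_eq_pow_mod_two (-1) m']
  rcases Nat.mod_two_eq_zero_or_one m with h | h <;>
    rcases Nat.mod_two_eq_zero_or_one m' with h' | h' <;> rw [h, h'] <;> decide

variable {N : ℕ}

theorem chainA_eq_iff (hN : 2 ≤ N) (e e' : Fin (2 * N)) :
    chainA e = chainA e' ↔ ((e : ℕ) + 1) / 2 = ((e' : ℕ) + 1) / 2 ∨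
      ((e : ℕ) = 0 ∧ (e' : ℕ) + 1 = 2 * N) ∨ ((e' : ℕ) = 0 ∧ (e : ℕ) + 1 = 2 * N) := by
  have h : ∀ e : Fin (2 * N), ((e : ℕ) + 1 < 2 * N ∧ ((e : ℕ) + 1) / 2 % N = ((e : ℕ) + 1) / 2) ∨
      ((e : ℕ) + 1 = 2 * N ∧ ((e : ℕ) + 1) / 2 % N = 0) := fun e => by
    rcases Nat.lt_or_ge ((e : ℕ) + 1) (2 * N) with h | h
    · exact .inl ⟨h, Nat.mod_eq_of_lt (by omega)⟩
    · have he : (e : ℕ) + 1 = 2 * N := by have := e.isLt; omega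
      exact .inr ⟨he, by rw [he]; simp⟩
  simp only [chainA, Fin.mk.injEq]
  have h1 := h e
  have h2 := h e'
  omega

theorem chainB_eq_iff (e e' : Fin (2 * N)) :
    chainB e = chainB e' ↔ (e : ℕ) / 2 = (e' : ℕ) / 2 := by
  simp [chainB]

/-- Whether Bob's outcome in an event differs from the alternating pattern along the terms. -/
def ChainEvent.half (i : ChainEvent N) : ℕ := if i.outB = (-1) ^ (i.1 : ℕ) then 0 else 1

theorem ChainEvent.half_lt (i : ChainEvent N) : i.half < 2 := by
  unfold ChainEvent.half; split_ifs <;> omega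

theorem ChainEvent.outB_eq (i : ChainEvent N) : i.outB = (-1) ^ ((i.1 : ℕ) + i.half) := by
  unfold ChainEvent.half
  split_ifs with h
  · exact h
  · rw [pow_succ, mul_neg, mul_one, ← Int.units_ne_iff_eq_neg]
    exact h

theorem ChainEvent.snd_eq (i : ChainEvent N) :
    i.2 = (-1) ^ ((i.1 : ℕ) + i.half + if (i.1 : ℕ) + 1 = 2 * N then 1 else 0) := by
  have h : i.2 = chainSign i.1 * i.outB := by
    rw [ChainEvent.outB, ← mul_assoc, Int.units_mul_self, one_mul]
  rw [h, i.outB_eq, pow_add _ _ (ite _ _ _), mul_comm, chainSign]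
  split_ifs <;> simp

/-- The number `e + 2N · half` turns adjacency into differences `±1` or `2N` modulo `4N`. Different
outcomes in neighbouring terms mean equal `half`, those in the same term mean different `half`; the
minus sign of the last term joins the first and the last term with different `half`, which closes
the single cycle of length `4N`. -/
theorem chainedExclusivityGraph_adj_iff (hN : 2 ≤ N) (i j : ChainEvent N) :
    (chainedExclusivityGraph N).Adj i j ↔
      (i.1 + 2 * N * i.half + 1 = j.1 + 2 * N * j.half ∨
        j.1 + 2 * N * j.half + 1 = i.1 + 2 * N * i.half ∨
        (i.1 + 2 * N * i.half = 0 ∧ j.1 + 2 * N * j.half + 1 = 4 * N) ∨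
        (j.1 + 2 * N * j.half = 0 ∧ i.1 + 2 * N * i.half + 1 = 4 * N) ∨
        i.1 + 2 * N * i.half + 2 * N = j.1 + 2 * N * j.half ∨
        j.1 + 2 * N * j.half + 2 * N = i.1 + 2 * N * i.half) := by
  have hi := i.1.isLt
  have hj := j.1.isLt
  change (chainA i.1 = chainA j.1 ∧ i.2 ≠ j.2) ∨ (chainB i.1 = chainB j.1 ∧ i.outB ≠ j.outB) ↔ _
  rw [chainA_eq_iff hN, chainB_eq_iff, i.snd_eq, j.snd_eq, i.outB_eq, j.outB_eq, Ne, Ne,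
    units_neg_one_pow_eq_iff, units_neg_one_pow_eq_iff]
  have hit := i.half_lt
  have hjt := j.half_lt
  generalize i.half = t at *
  generalize j.half = t' at *
  generalize (i.1 : ℕ) = e at *
  generalize (j.1 : ℕ) = e' at *
  interval_cases t <;> interval_cases t' <;> split_ifs <;> omega

theorem natCast_sub_eq_natCast_iff {M k k' d : ℕ} (hk : k < M) (hk' : k' < M) (hd : d < M) :
    ((k : ZMod M) - k' = d) ↔ k = k' + d ∨ k + M = k' + d := by
  rw [sub_eq_iff_eq_add, ← Nat.cast_add, ZMod.natCast_eq_natCast_iff, Nat.ModEq,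
    Nat.mod_eq_of_lt hk, add_comm d k']
  rcases Nat.lt_or_ge (k' + d) M with h | h
  · rw [Nat.mod_eq_of_lt h]; omega
  · rw [Nat.mod_eq_sub_mod h, Nat.mod_eq_of_lt (by omega)]; omega

/-- The position of an event in the Hamiltonian cycle of the exclusivity graph. -/
def ChainEvent.position (i : ChainEvent N) : ZMod (4 * N) := ((i.1 + 2 * N * i.half : ℕ) : ZMod _)

theorem ChainEvent.position_lt (i : ChainEvent N) : i.1 + 2 * N * i.half < 4 * N := by
  have hi := i.1.isLt
  have hit := i.half_lt
  generalize i.half = t at *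
  interval_cases t <;> omega

theorem ChainEvent.position_injective : Function.Injective (ChainEvent.position (N := N)) := by
  intro i j h
  rw [ChainEvent.position, ChainEvent.position, ZMod.natCast_eq_natCast_iff, Nat.ModEq,
    Nat.mod_eq_of_lt i.position_lt, Nat.mod_eq_of_lt j.position_lt] at h
  have hi := i.1.isLt
  have hj := j.1.isLt
  have hit := i.half_lt
  have hjt := j.half_lt
  have h1 : (i.1 : ℕ) = j.1 ∧ i.half = j.half := by
    generalize i.half = t at *
    generalize j.half = t' at *
    interval_cases t <;> interval_cases t' <;> omega
  refine Prod.ext (Fin.ext h1.1) ?_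
  rw [i.snd_eq, j.snd_eq, h1.1, h1.2]

/-- The exclusivity graph of the chained Bell expression is a Möbius ladder. -/
theorem nonempty_chainedExclusivityGraph_iso (hN : 2 ≤ N) :
    Nonempty (chainedExclusivityGraph N ≃g
      SimpleGraph.circulantGraph ({1, ((2 * N : ℕ) : ZMod (4 * N))} : Set (ZMod (4 * N)))) := by
  have : NeZero (4 * N) := ⟨by omega⟩
  refine ⟨⟨Equiv.ofBijective ChainEvent.position
    ((Fintype.bijective_iff_injective_and_card _).2 ⟨ChainEvent.position_injective, ?_⟩), ?_⟩⟩
  · rw [ZMod.card, Fintype.card_prod, Fintype.card_fin, Fintype.card_units_int]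
    ring
  · intro i j
    have hi := i.position_lt
    have hj := j.position_lt
    rw [chainedExclusivityGraph_adj_iff hN]
    simp only [Equiv.ofBijective_apply, SimpleGraph.circulantGraph, SimpleGraph.fromRel_adj,
      ChainEvent.position, Set.mem_insert_iff, Set.mem_singleton_iff, Ne]
    rw [← Nat.cast_one, natCast_sub_eq_natCast_iff hi hj (by omega),
      natCast_sub_eq_natCast_iff hi hj (by omega), natCast_sub_eq_natCast_iff hj hi (by omega),
      natCast_sub_eq_natCast_iff hj hi (by omega), ZMod.natCast_eq_natCast_iff, Nat.ModEq,
      Nat.mod_eq_of_lt hi, Nat.mod_eq_of_lt hj]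
    omega

end MobiusLadder

/-! ### The events along the ladder -/

section ChainEv

variable {N : ℕ} [NeZero N]

/-- The event of the `e`-th rung of the ladder in which Bob obtains `b`; the rungs are numbered by
`ℕ`, and going once around the ladder exchanges the outcomes. -/
def chainEv (N : ℕ) [NeZero N] (e : ℕ) (b : ℤˣ) : ChainEvent N :=
  let r : Fin (2 * N) := ⟨e % (2 * N), Nat.mod_lt _ (by have := NeZero.pos N; omega)⟩
  (r, chainSign r * ((-1) ^ (e / (2 * N)) * b))

theorem chainB_chainEv (e : ℕ) (b : ℤˣ) :
    chainB (chainEv N e b).1 = ⟨e / 2 % N, Nat.mod_lt _ (NeZero.pos N)⟩ := by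
  simp only [chainB, chainEv, Fin.mk.injEq]
  exact Nat.mod_mul_right_div_self e 2 N

theorem outB_chainEv (e : ℕ) (b : ℤˣ) : (chainEv N e b).outB = (-1) ^ (e / 2 / N) * b := by
  rw [Nat.div_div_eq_div_mul, ChainEvent.outB, chainEv, ← mul_assoc, Int.units_mul_self, one_mul]

theorem chainA_chainEv (e : ℕ) (b : ℤˣ) :
    chainA (chainEv N e b).1 = ⟨(e + 1) / 2 % N, Nat.mod_lt _ (NeZero.pos N)⟩ := by
  simp only [chainA, chainEv, Fin.mk.injEq]
  conv_rhs => rw [← Nat.mod_add_div e (2 * N), mul_assoc, add_right_comm,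
    Nat.add_mul_div_left _ _ two_pos, Nat.add_mul_mod_self_left]

theorem snd_chainEv (e : ℕ) (b : ℤˣ) :
    (chainEv N e b).2 = (-1) ^ ((e + 1) / 2 / N) * b := by
  have hN := NeZero.pos N
  have h1 : (e + 1) / 2 / N = (e % (2 * N) + 1) / 2 / N + e / (2 * N) := by
    conv_lhs => rw [← Nat.mod_add_div e (2 * N), mul_assoc, add_right_comm,
      Nat.add_mul_div_left _ _ two_pos, Nat.add_mul_div_left _ _ hN]
  have hr := Nat.mod_lt e (show 0 < 2 * N by omega)
  rw [h1, chainEv, pow_add, mul_assoc, chainSign]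
  simp only
  split_ifs with h
  · rw [h, Nat.mul_div_cancel_left _ two_pos, Nat.div_self hN, pow_one]
  · have h2 : (e % (2 * N) + 1) / 2 / N = 0 := Nat.div_eq_of_lt (by omega)
    rw [h2, pow_zero]

theorem chainEv_add (e : ℕ) (b : ℤˣ) : chainEv N (e + 2 * N) b = chainEv N e (-b) := by
  have h : (e + 2 * N) / (2 * N) = e / (2 * N) + 1 :=
    Nat.add_div_right _ (by have := NeZero.pos N; omega)
  simp only [chainEv, Nat.add_mod_right, h, pow_succ, mul_neg, mul_one, neg_mul]

theorem units_neg_one_pow_mul_ne (k : ℕ) (b : ℤˣ) :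
    (-1 : ℤˣ) ^ k * b ≠ (-1) ^ k * -b := by
  rw [Ne, mul_right_inj]; exact units_ne_neg_self b

theorem adj_chainEv_neg (e : ℕ) (b : ℤˣ) :
    (chainedExclusivityGraph N).Adj (chainEv N e b) (chainEv N e (-b)) :=
  .inr ⟨rfl, by rw [outB_chainEv, outB_chainEv]; exact units_neg_one_pow_mul_ne _ _⟩

theorem adj_chainEv_succ (e : ℕ) (b : ℤˣ) :
    (chainedExclusivityGraph N).Adj (chainEv N e b) (chainEv N (e + 1) (-b)) := by
  rcases Nat.even_or_odd' e with ⟨k, rfl | rfl⟩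
  · refine .inr ⟨?_, ?_⟩
    · rw [chainB_chainEv, chainB_chainEv]; simp; congr 1; omega
    · rw [outB_chainEv, outB_chainEv, show (2 * k + 1) / 2 = 2 * k / 2 by omega]
      exact units_neg_one_pow_mul_ne _ _
  · refine .inl ⟨?_, ?_⟩
    · rw [chainA_chainEv, chainA_chainEv]; simp; congr 1; omega
    · rw [snd_chainEv, snd_chainEv, show (2 * k + 1 + 1 + 1) / 2 = (2 * k + 1 + 1) / 2 by omega]
      exact units_neg_one_pow_mul_ne _ _

theorem chainEv_outB (i : ChainEvent N) : chainEv N i.1 i.outB = i := by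
  have h1 : (i.1 : ℕ) % (2 * N) = i.1 := Nat.mod_eq_of_lt i.1.isLt
  have h2 : (i.1 : ℕ) / (2 * N) = 0 := Nat.div_eq_of_lt i.1.isLt
  refine Prod.ext (Fin.ext h1) ?_
  simp only [chainEv, h1, h2, pow_zero, one_mul, ChainEvent.outB, Fin.eta]
  rw [← mul_assoc, Int.units_mul_self, one_mul]

theorem sum_units_int {M : Type*} [AddCommMonoid M] (g : ℤˣ → M) :
    ∑ b, g b = g 1 + g (-1) := by
  rw [show (Finset.univ : Finset ℤˣ) = {1, -1} by decide]
  exact Finset.sum_pair (by decide)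

theorem sum_chainEvent {M : Type*} [AddCommMonoid M] (g : ChainEvent N → M) :
    ∑ i, g i = ∑ e ∈ Finset.range (2 * N), (g (chainEv N e 1) + g (chainEv N e (-1))) := by
  rw [Fintype.sum_prod_type, Finset.sum_range]
  refine Finset.sum_congr rfl fun e _ => ?_
  have h : ∀ b, g (chainEv N e b) = g (e, chainSign e * b) := fun b => by
    rw [← chainEv_outB (e, chainSign e * b), ChainEvent.outB]
    simp only [← mul_assoc, Int.units_mul_self, one_mul]
  rw [h, h, ← sum_units_int fun b => g (e, chainSign e * b)]
  exact (Equiv.sum_comp (Equiv.mulLeft (chainSign e)) fun b => g (e, b)).symm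

end ChainEv

/-! ### Feasible matrices of the theta program as Gram matrices -/

section ThetaFamily

variable {V : Type*} {H : Type*} [NormedAddCommGroup H] [InnerProductSpace ℂ H]

/-- A family of vectors whose Gram matrix is feasible for the theta program of `G`. -/
structure IsThetaFamily (G : SimpleGraph V) (w : Option V → H) : Prop where
  norm_none : ‖w none‖ = 1
  diag : ∀ i, inner ℂ (w (some i)) (w (some i)) = inner ℂ (w none) (w (some i))
  edge : ∀ i j, G.Adj i j → inner ℂ (w (some i)) (w (some j)) = 0

/-- The matrix is the transpose of the Gram matrix, as in `chainedGram`, so the diagonal condition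
passes through a complex conjugation. -/
theorem thetaFeasible_iff_isThetaFamily [Finite V] {G : SimpleGraph V}
    {X : Matrix (Option V) (Option V) ℂ} {w : Option V → H}
    (hX : ∀ i j, X i j = inner ℂ (w j) (w i)) : ThetaFeasible G X ↔ IsThetaFamily G w := by
  have hd : ∀ i, X (some i) (some i) = X none (some i) ↔
      inner ℂ (w (some i)) (w (some i)) = inner ℂ (w none) (w (some i)) := fun i => by
    rw [hX, hX]
    constructor <;> intro h
    · rw [← inner_conj_symm (w none), ← h, inner_conj_symm]
    · rw [← inner_conj_symm (w (some i)) (w none), ← h, inner_conj_symm]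
  constructor
  · intro h
    refine ⟨?_, fun i => (hd i).1 (h.diag i), fun i j hij => ?_⟩
    · have := h.corner
      rw [hX, inner_self_eq_norm_sq_to_K] at this
      have h2 : ‖w none‖ ^ 2 = 1 := Complex.ofReal_injective (by simpa using this)
      exact (pow_eq_one_iff_of_nonneg (norm_nonneg _) two_ne_zero).1 h2
    · rw [← hX]; exact h.edge j i hij.symm
  · intro h
    refine ⟨?_, ?_, fun i => (hd i).2 (h.diag i), fun i j hij => ?_⟩
    · have h1 : X = (Matrix.gram ℂ w).transpose := by
        ext i j; simp [hX]
      rw [h1]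
      exact (Matrix.posSemidef_gram ℂ w).transpose
    · rw [hX, inner_self_eq_norm_sq_to_K, h.norm_none]; simp
    · rw [hX]; exact h.edge j i hij.symm

open scoped MatrixOrder in
theorem exists_gram_of_posSemidef {ι : Type*} [Fintype ι] {X : Matrix ι ι ℂ} (hX : X.PosSemidef) :
    ∃ w : ι → EuclideanSpace ℂ ι, ∀ i j, X i j = inner ℂ (w j) (w i) := by
  classical
  obtain ⟨B, hB⟩ := CStarAlgebra.nonneg_iff_eq_star_mul_self.mp hX.transpose.nonneg
  refine ⟨fun i => WithLp.toLp 2 fun k => B k i, fun i j => ?_⟩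
  rw [← Matrix.transpose_apply X, hB]
  simp [Matrix.mul_apply, Matrix.star_apply, PiLp.inner_apply, mul_comm]

variable {N : ℕ} [NeZero N]

theorem IsThetaFamily.isLadderFamily {w : Option (ChainEvent N) → H}
    (h : IsThetaFamily (chainedExclusivityGraph N) w) :
    IsLadderFamily (2 * N) (w none) fun e b => w (some (chainEv N e b)) where
  norm_base := h.norm_none
  shift e b := by rw [chainEv_add]
  diag e b := h.diag _
  rung e := h.edge _ _ (adj_chainEv_neg e 1)
  link e b := h.edge _ _ (adj_chainEv_succ e b)

theorem IsThetaFamily.thetaObjective_eq {w : Option (ChainEvent N) → H}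
    (h : IsThetaFamily (chainedExclusivityGraph N) w)
    {X : Matrix (Option (ChainEvent N)) (Option (ChainEvent N)) ℂ}
    (hX : ∀ i j, X i j = inner ℂ (w j) (w i)) :
    thetaObjective X = ∑ e ∈ Finset.range (2 * N),
      ‖ladderSum (fun e b => w (some (chainEv N e b))) e‖ ^ 2 := by
  rw [thetaObjective, sum_chainEvent]
  refine Finset.sum_congr rfl fun e _ => ?_
  rw [h.isLadderFamily.norm_sum_sq, hX, hX, h.diag, h.diag, ladderSum, inner_add_right,
    Complex.add_re]

theorem ThetaFeasible.thetaObjective_le {X : Matrix (Option (ChainEvent N)) (Option (ChainEvent N)) ℂ}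
    (h : ThetaFeasible (chainedExclusivityGraph N) X) :
    thetaObjective X ≤ N * (1 + Real.cos (Real.pi / (2 * N))) := by
  obtain ⟨w, hw⟩ := exists_gram_of_posSemidef h.posSemidef
  have h1 := (thetaFeasible_iff_isThetaFamily hw).1 h
  rw [h1.thetaObjective_eq hw]
  have h2 := h1.isLadderFamily.sum_le (by have := NeZero.pos N; omega)
  push_cast at h2
  linarith

theorem IsThetaFamily.isExtremal {w : Option (ChainEvent N) → H}
    (h : IsThetaFamily (chainedExclusivityGraph N) w)
    {X : Matrix (Option (ChainEvent N)) (Option (ChainEvent N)) ℂ}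
    (hX : ∀ i j, X i j = inner ℂ (w j) (w i))
    (hval : thetaObjective X = N * (1 + Real.cos (Real.pi / (2 * N)))) :
    IsLadderFamily.IsExtremal (2 * N) (w none) fun e b => w (some (chainEv N e b)) := by
  refine ⟨h.isLadderFamily, ?_⟩
  rw [← h.thetaObjective_eq hX, hval]
  push_cast
  ring

/-- The Gram vectors of the two matrices are unrelated, but `inner_eq` gives their event entries the
same explicit values; feasibility then fixes the row and column of index `0`. -/
theorem ThetaFeasible.eq_of_thetaObjective_eq (hN : 2 ≤ N)
    {X Y : Matrix (Option (ChainEvent N)) (Option (ChainEvent N)) ℂ}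
    (hX : ThetaFeasible (chainedExclusivityGraph N) X)
    (hXv : thetaObjective X = N * (1 + Real.cos (Real.pi / (2 * N))))
    (hY : ThetaFeasible (chainedExclusivityGraph N) Y)
    (hYv : thetaObjective Y = N * (1 + Real.cos (Real.pi / (2 * N)))) : X = Y := by
  have hsome : ∀ i j, X (some i) (some j) = Y (some i) (some j) := fun i j => by
    obtain ⟨w, hw⟩ := exists_gram_of_posSemidef hX.posSemidef
    obtain ⟨w', hw'⟩ := exists_gram_of_posSemidef hY.posSemidef
    have h := ((thetaFeasible_iff_isThetaFamily hw).1 hX).isExtremal hw hXv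
    have h' := ((thetaFeasible_iff_isThetaFamily hw').1 hY).isExtremal hw' hYv
    have h1 := h.inner_eq (by omega) (even_two_mul N) j.1 i.1 j.outB i.outB
    rw [← h'.inner_eq (by omega) (even_two_mul N) j.1 i.1 j.outB i.outB] at h1
    simpa only [chainEv_outB, ← hw, ← hw'] using h1
  have hnone : ∀ i, X none (some i) = Y none (some i) := fun i => by
    rw [← hX.diag, ← hY.diag, hsome]
  ext (_ | i) (_ | j)
  · rw [hX.corner, hY.corner]
  · exact hnone j
  · rw [← hX.posSemidef.1.apply, ← hY.posSemidef.1.apply, hnone]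
  · exact hsome i j

end ThetaFamily

/-! ### The matrix of a realization -/

namespace BellRealization

variable {N : ℕ} {HA : Type*} {HB : Type*} [NormedAddCommGroup HA] [InnerProductSpace ℂ HA]
  [NormedAddCommGroup HB] [InnerProductSpace ℂ HB]

theorem inner_map_left_of_isSymmetric {f : HA →ₗ[ℂ] HA} {g : HB →ₗ[ℂ] HB} (hf : f.IsSymmetric)
    (hg : g.IsSymmetric) (x y : HA ⊗[ℂ] HB) :
    inner ℂ (TensorProduct.map f g x) y = inner ℂ x (TensorProduct.map f g y) := by
  induction x with
  | zero => simp
  | add x x' hx hx' => rw [map_add, inner_add_left, inner_add_left, hx, hx']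
  | tmul a b =>
    induction y with
    | zero => simp
    | add y y' hy hy' => rw [map_add, inner_add_right, inner_add_right, hy, hy']
    | tmul a' b' => simp [hf a a', hg b b']

variable (S : BellRealization N HA HB)

theorem inner_eventVec_eventVec (x y x' y' : Fin N) (a b a' b' : ℤˣ) :
    inner ℂ (S.eventVec x y a b) (S.eventVec x' y' a' b') =
      inner ℂ S.state (TensorProduct.map (S.projA x a * S.projA x' a')
        (S.projB y b * S.projB y' b') S.state) := by
  rw [eventVec, eventVec, inner_map_left_of_isSymmetric (S.projA_isProj x a).isSymmetric
    (S.projB_isProj y b).isSymmetric, Module.End.mul_eq_comp, Module.End.mul_eq_comp,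
    TensorProduct.map_comp, LinearMap.comp_apply]

theorem inner_eventVec_self (x y : Fin N) (a b : ℤˣ) :
    inner ℂ (S.eventVec x y a b) (S.eventVec x y a b) =
      inner ℂ S.state (S.eventVec x y a b) := by
  rw [inner_eventVec_eventVec, (S.projA_isProj x a).isIdempotentElem,
    (S.projB_isProj y b).isIdempotentElem, eventVec]

variable {S}

theorem mul_eq_zero_of_sum_eq_id {H : Type*} [NormedAddCommGroup H] [InnerProductSpace ℂ H]
    {P : ℤˣ → (H →ₗ[ℂ] H)} (hP : ∀ a, (P a).IsSymmetricProjection)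
    (h : ∑ a, P a = LinearMap.id) {a a' : ℤˣ} (ha : a ≠ a') : P a * P a' = 0 := by
  have h1 : P a' = 1 - P a := by
    rw [eq_sub_iff_add_eq, Module.End.one_eq_id, ← h, sum_units_int]
    rcases Int.units_eq_one_or a with rfl | rfl <;>
      rcases Int.units_eq_one_or a' with rfl | rfl
    · exact absurd rfl ha
    · exact add_comm _ _
    · rfl
    · exact absurd rfl ha
  rw [h1, mul_sub, mul_one, (hP a).isIdempotentElem, sub_self]

theorem IsMeasurement.isThetaFamily (h : S.IsMeasurement) :
    IsThetaFamily (chainedExclusivityGraph N) (chainedVec S) where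
  norm_none := S.norm_state
  diag i := S.inner_eventVec_self _ _ _ _
  edge i j hij := by
    rw [chainedVec, chainedVec, inner_eventVec_eventVec]
    rcases hij with ⟨h1, h2⟩ | ⟨h1, h2⟩
    · rw [h1, mul_eq_zero_of_sum_eq_id (S.projA_isProj _) (h.1 _) h2, TensorProduct.map_zero_left]
      simp
    · rw [h1, mul_eq_zero_of_sum_eq_id (S.projB_isProj _) (h.2 _) h2, TensorProduct.map_zero_right]
      simp

theorem IsMeasurement.thetaFeasible (h : S.IsMeasurement) :
    ThetaFeasible (chainedExclusivityGraph N) (chainedGram S) :=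
  (thetaFeasible_iff_isThetaFamily fun _ _ => rfl).2 h.isThetaFamily

theorem IsMeasurement.sum_prob (h : S.IsMeasurement) (x y : Fin N) :
    S.prob x y 1 1 + S.prob x y (-1) (-1) + S.prob x y 1 (-1) + S.prob x y (-1) 1 = 1 := by
  have h1 : S.eventVec x y 1 1 + S.eventVec x y (-1) (-1) + S.eventVec x y 1 (-1) +
      S.eventVec x y (-1) 1 = S.state := by
    have hA := h.1 x
    have hB := h.2 y
    rw [sum_units_int] at hA hB
    have h2 : TensorProduct.map (S.projA x 1 + S.projA x (-1)) (S.projB y 1 + S.projB y (-1))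
        S.state = S.state := by rw [hA, hB, TensorProduct.map_id, LinearMap.id_apply]
    rw [TensorProduct.map_add_left, TensorProduct.map_add_right, TensorProduct.map_add_right] at h2
    simp only [LinearMap.add_apply] at h2
    conv_rhs => rw [← h2]
    simp only [eventVec]
    abel
  have h2 : inner ℂ S.state S.state = (1 : ℂ) := by
    rw [inner_self_eq_norm_sq_to_K (E := HA ⊗[ℂ] HB), S.norm_state]; simp
  simp only [prob, ← Complex.add_re, ← inner_add_right (E := HA ⊗[ℂ] HB)]
  rw [h1, h2, Complex.one_re]

theorem correlator_eq (x y : Fin N) : S.correlator x y =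
    S.prob x y 1 1 + S.prob x y (-1) (-1) - S.prob x y 1 (-1) - S.prob x y (-1) 1 := by
  simp only [correlator, sum_units_int, mul_one, mul_neg, neg_neg]
  push_cast
  ring

/-- The four probabilities of a term add up to `1`, so its two events contribute `(1 + sign ·
correlator) / 2`. -/
theorem IsMeasurement.thetaObjective_eq (h : S.IsMeasurement) :
    thetaObjective (chainedGram S) = N + chainedBell S / 2 := by
  rw [thetaObjective, Fintype.sum_prod_type, chainedBell, Finset.sum_div]
  have h1 : (N : ℝ) = ∑ e : Fin (2 * N), 1 / 2 := by simp; ring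
  rw [h1, ← Finset.sum_add_distrib]
  refine Finset.sum_congr rfl fun e _ => ?_
  have h2 : ∀ a : ℤˣ, (chainedGram S (some (e, a)) (some (e, a))).re =
      S.prob (chainA e) (chainB e) a (chainSign e * a) := fun a => by
    rw [chainedGram, chainedVec, inner_eventVec_self]; rfl
  have h3 := h.sum_prob (chainA e) (chainB e)
  rw [sum_units_int, h2, h2, correlator_eq]
  rcases Int.units_eq_one_or (chainSign e) with hs | hs <;> rw [hs] <;>
    simp only [mul_one, one_mul, neg_mul, neg_neg] <;> push_cast <;> linarith

end BellRealization

/-! ### Rank-one projections -/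

section RankOne

variable {HA : Type*} {HB : Type*} [NormedAddCommGroup HA] [InnerProductSpace ℂ HA]
  [NormedAddCommGroup HB] [InnerProductSpace ℂ HB]

theorem map_rankOne_self (α : HA) (β : HB) (x : HA ⊗[ℂ] HB) :
    TensorProduct.map (InnerProductSpace.rankOne ℂ α α).toLinearMap
      (InnerProductSpace.rankOne ℂ β β).toLinearMap x = inner ℂ (α ⊗ₜ[ℂ] β) x • α ⊗ₜ[ℂ] β := by
  induction x with
  | zero => simp
  | add x y hx hy => rw [map_add, hx, hy, inner_add_right (E := HA ⊗[ℂ] HB), add_smul]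
  | tmul a b => simp [← TensorProduct.smul_tmul', smul_smul, mul_comm]

theorem exists_eq_rankOne {P : HA →ₗ[ℂ] HA} (hP : P.IsSymmetricProjection)
    (h : Module.finrank ℂ (LinearMap.range P) = 1) :
    ∃ α : HA, ‖α‖ = 1 ∧ P = (InnerProductSpace.rankOne ℂ α α).toLinearMap := by
  obtain ⟨⟨w, hw⟩, hw0, hspan⟩ := finrank_eq_one_iff'.1 h
  have hw1 : w ≠ 0 := fun h => hw0 (Subtype.ext h)
  have hnw : (‖w‖ : ℂ) ≠ 0 := by simpa using hw1
  set α : HA := (‖w‖ : ℂ)⁻¹ • w with hα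
  have hα1 : ‖α‖ = 1 := by
    rw [hα, norm_smul, norm_inv, Complex.norm_real, norm_norm,
      inv_mul_cancel₀ (norm_ne_zero_iff.2 hw1)]
  have hPα : P α = α := by
    obtain ⟨z, rfl⟩ := hw
    rw [hα, map_smul, ← Module.End.mul_apply, hP.isIdempotentElem]
  refine ⟨α, hα1, LinearMap.ext fun x => ?_⟩
  obtain ⟨c, hc⟩ := hspan ⟨P x, x, rfl⟩
  have hc' : P x = (c * ‖w‖) • α := by
    rw [hα, smul_smul, mul_assoc, mul_inv_cancel₀ hnw, mul_one]
    exact (congrArg Subtype.val hc).symm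
  have h1 : inner ℂ α x = c * ‖w‖ := by
    rw [← hPα, hP.isSymmetric, hc', inner_smul_right, inner_self_eq_norm_sq_to_K, hα1]
    simp
  rw [hc', ← h1]
  rfl

theorem finrank_range_rankOne_self {α : HA} (hα : ‖α‖ = 1) :
    Module.finrank ℂ (LinearMap.range (InnerProductSpace.rankOne ℂ α α).toLinearMap) = 1 := by
  have hα0 : α ≠ 0 := fun h => by simp [h] at hα
  have : LinearMap.range (InnerProductSpace.rankOne ℂ α α).toLinearMap = ℂ ∙ α := by
    ext x
    rw [LinearMap.mem_range, Submodule.mem_span_singleton]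
    constructor
    · rintro ⟨y, rfl⟩
      exact ⟨_, rfl⟩
    · rintro ⟨c, rfl⟩
      refine ⟨c • α, ?_⟩
      simp [hα]
  rw [this, finrank_span_singleton hα0]

end RankOne

/-! ### The standard realization -/

section Reference

theorem qubitProj_one (φ : ℝ) : qubitProj φ 1 =
    (InnerProductSpace.rankOne ℂ (qubitVec (φ / 2)) (qubitVec (φ / 2))).toLinearMap := by
  simp [qubitProj]

theorem qubitProj_neg_one (φ : ℝ) : qubitProj φ (-1) =
    (InnerProductSpace.rankOne ℂ (qubitVec (φ / 2 + Real.pi / 2))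
      (qubitVec (φ / 2 + Real.pi / 2))).toLinearMap := by
  simp [qubitProj, show (-1 : ℤˣ) ≠ 1 by decide]

theorem sum_qubitProj (φ : ℝ) : ∑ a, qubitProj φ a = LinearMap.id := by
  have h : ((Real.cos (φ / 2) : ℝ) : ℂ) ^ 2 + ((Real.sin (φ / 2) : ℝ) : ℂ) ^ 2 = 1 := by
    exact_mod_cast Real.cos_sq_add_sin_sq (φ / 2)
  rw [sum_units_int, qubitProj_one, qubitProj_neg_one]
  ext x i
  fin_cases i
  all_goals
    simp [qubitVec, PiLp.inner_apply, Real.cos_add_pi_div_two, Real.sin_add_pi_div_two,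
      -Complex.ofReal_cos, -Complex.ofReal_sin]
  · linear_combination x.ofLp 0 * h
  · linear_combination x.ofLp 1 * h

theorem inner_qubitVec_tmul_phiPlus (s t : ℝ) :
    inner ℂ (qubitVec s ⊗ₜ[ℂ] qubitVec t) phiPlus = ((Real.cos (s - t) / Real.sqrt 2 : ℝ) : ℂ) := by
  rw [phiPlus, inner_smul_right (E := Qubit ⊗[ℂ] Qubit), inner_add_right (E := Qubit ⊗[ℂ] Qubit),
    TensorProduct.inner_tmul, TensorProduct.inner_tmul, Real.cos_sub]
  simp [qubitVec, EuclideanSpace.inner_single_right, -Complex.ofReal_cos, -Complex.ofReal_sin]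
  ring

variable (N : ℕ)

theorem chainedReference_isMeasurement : (chainedReference N).IsMeasurement :=
  ⟨fun _ => sum_qubitProj _, fun _ => sum_qubitProj _⟩

theorem chainedReference_isRankOne : (chainedReference N).IsRankOne :=
  ⟨fun _ _ => finrank_range_rankOne_self (norm_qubitVec _),
    fun _ _ => finrank_range_rankOne_self (norm_qubitVec _)⟩

/-- The angle of the vector onto which `qubitProj φ a` projects. -/
noncomputable def qubitAngle (φ : ℝ) (a : ℤˣ) : ℝ := if a = 1 then φ / 2 else φ / 2 + Real.pi / 2

theorem chainedReference_prob (x y : Fin N) (a b : ℤˣ) :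
    (chainedReference N).prob x y a b =
      Real.cos (qubitAngle (2 * (x : ℕ) * (Real.pi / (2 * N))) a -
        qubitAngle ((2 * (y : ℕ) + 1) * (Real.pi / (2 * N))) b) ^ 2 / 2 := by
  have h : (chainedReference N).eventVec x y a b = _ := map_rankOne_self _ _ phiPlus
  rw [BellRealization.prob, h, inner_smul_right (E := Qubit ⊗[ℂ] Qubit),
    ← inner_conj_symm (E := Qubit ⊗[ℂ] Qubit) _ (qubitVec _ ⊗ₜ[ℂ] qubitVec _)]
  change (inner ℂ _ phiPlus * (starRingEnd ℂ) (inner ℂ _ phiPlus)).re = _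
  rw [inner_qubitVec_tmul_phiPlus, Complex.conj_ofReal, ← Complex.ofReal_mul, Complex.ofReal_re,
    div_mul_div_comm, Real.mul_self_sqrt two_pos.le, ← sq]
  rfl

theorem chainedReference_correlator (x y : Fin N) :
    (chainedReference N).correlator x y = Real.cos (2 * (x : ℕ) * (Real.pi / (2 * N)) -
      (2 * (y : ℕ) + 1) * (Real.pi / (2 * N))) := by
  have h1 : (-1 : ℤˣ) ≠ 1 := by decide
  rw [BellRealization.correlator_eq]
  simp only [chainedReference_prob, qubitAngle, if_true, if_neg h1]
  generalize 2 * ((x : ℕ) : ℝ) * (Real.pi / (2 * N)) = s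
  generalize (2 * ((y : ℕ) : ℝ) + 1) * (Real.pi / (2 * N)) = t
  rw [show s / 2 + Real.pi / 2 - (t / 2 + Real.pi / 2) = s / 2 - t / 2 by ring,
    show s / 2 - (t / 2 + Real.pi / 2) = (s / 2 - t / 2) - Real.pi / 2 by ring,
    show s / 2 + Real.pi / 2 - t / 2 = (s / 2 - t / 2) + Real.pi / 2 by ring,
    show s - t = 2 * (s / 2 - t / 2) by ring, Real.cos_two_mul, Real.cos_sub_pi_div_two,
    Real.cos_add_pi_div_two]
  have := Real.sin_sq_add_cos_sq (s / 2 - t / 2)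
  linear_combination -this

theorem chainedBell_chainedReference (hN : 2 ≤ N) :
    chainedBell (chainedReference N) = 2 * N * Real.cos (Real.pi / (2 * N)) := by
  have h : ∀ e : Fin (2 * N), ((chainSign e : ℤ) : ℝ) *
      (chainedReference N).correlator (chainA e) (chainB e) = Real.cos (Real.pi / (2 * N)) := by
    intro e
    rw [chainedReference_correlator]
    have hN0 : (N : ℝ) ≠ 0 := by positivity
    have he := e.isLt
    simp only [chainSign, chainA, chainB]
    split_ifs with h
    -- In the last term the angles of the two observables differ by `π - π/(2N)`; the sign of the
    -- term compensates the negative cosine.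
    · rw [h, Nat.mul_div_cancel_left _ two_pos, Nat.mod_self, show (e : ℕ) / 2 = N - 1 by omega,
        Nat.cast_sub (by omega),
        show 2 * ((0 : ℕ) : ℝ) * (Real.pi / (2 * N)) -
          (2 * ((N : ℝ) - (1 : ℕ)) + 1) * (Real.pi / (2 * N)) = -(Real.pi - Real.pi / (2 * N)) by
          field_simp; push_cast; ring, Real.cos_neg, Real.cos_pi_sub]
      simp
    · rw [Nat.mod_eq_of_lt (by omega)]
      rcases Nat.even_or_odd' (e : ℕ) with ⟨k, hk | hk⟩
      · rw [show ((e : ℕ) + 1) / 2 = k by omega, show (e : ℕ) / 2 = k by omega,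
          ← Real.cos_neg]
        push_cast; rw [one_mul]; congr 1; ring
      · rw [show ((e : ℕ) + 1) / 2 = k + 1 by omega, show (e : ℕ) / 2 = k by omega]
        push_cast; rw [one_mul]; congr 1; ring
  rw [chainedBell, Finset.sum_congr rfl fun e _ => h e]
  simp

theorem thetaObjective_chainedReference (hN : 2 ≤ N) :
    thetaObjective (chainedGram (chainedReference N)) =
      N * (1 + Real.cos (Real.pi / (2 * N))) := by
  rw [(chainedReference_isMeasurement N).thetaObjective_eq, chainedBell_chainedReference N hN]
  ring

end Reference

/-! ### Extremal families of product vectors -/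

section Contraction

variable {HA : Type*} {HB : Type*} [NormedAddCommGroup HA] [InnerProductSpace ℂ HA]
  [NormedAddCommGroup HB] [InnerProductSpace ℂ HB]

/-- The contraction `u ⊗ w ↦ ⟨α, u⟩ w`. -/
noncomputable def innerContractLeft (α : HA) : HA ⊗[ℂ] HB →ₗ[ℂ] HB :=
  (TensorProduct.lid ℂ HB).toLinearMap ∘ₗ (innerₛₗ ℂ α).rTensor HB

/-- The contraction `u ⊗ w ↦ ⟨β, w⟩ u`. -/
noncomputable def innerContractRight (β : HB) : HA ⊗[ℂ] HB →ₗ[ℂ] HA :=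
  (TensorProduct.rid ℂ HA).toLinearMap ∘ₗ (innerₛₗ ℂ β).lTensor HA

@[simp]
theorem innerContractLeft_tmul (α u : HA) (w : HB) :
    innerContractLeft α (u ⊗ₜ[ℂ] w) = inner ℂ α u • w := by
  simp [innerContractLeft]

@[simp]
theorem innerContractRight_tmul (β w : HB) (u : HA) :
    innerContractRight β (u ⊗ₜ[ℂ] w) = inner ℂ β w • u := by
  simp [innerContractRight]

end Contraction

section Orthonormal

variable {H : Type*} [NormedAddCommGroup H] [InnerProductSpace ℂ H]

theorem orthonormal_pair_iff {x y : H} :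
    Orthonormal ℂ ![x, y] ↔ ‖x‖ = 1 ∧ ‖y‖ = 1 ∧ inner ℂ x y = 0 := by
  constructor
  · intro h
    exact ⟨h.1 0, h.1 1, h.2 (show (0 : Fin 2) ≠ 1 by decide)⟩
  · rintro ⟨hx, hy, hxy⟩
    refine ⟨fun i => by fin_cases i <;> simpa, fun i j hij => ?_⟩
    fin_cases i <;> fin_cases j
    · exact absurd rfl hij
    · exact hxy
    · exact inner_eq_zero_symm.1 hxy
    · exact absurd rfl hij

theorem exists_linearIsometry_qubit {x y : Qubit} {x' y' : H} (h : Orthonormal ℂ ![x, y])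
    (h' : Orthonormal ℂ ![x', y']) : ∃ V : Qubit →ₗᵢ[ℂ] H, V x = x' ∧ V y = y' := by
  set bs := basisOfOrthonormalOfCardEqFinrank h (by simp) with hbs
  have hb : ⇑bs = ![x, y] := coe_basisOfOrthonormalOfCardEqFinrank h (by simp)
  have hf : ⇑(bs.constr ℂ ![x', y']) ∘ bs = ![x', y'] := funext fun i => bs.constr_basis ℂ _ i
  refine ⟨(bs.constr ℂ ![x', y']).isometryOfOrthonormal (by rwa [hb]) (by rwa [hf]), ?_, ?_⟩
  · have := congrFun hf 0
    rw [hb] at this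
    exact this
  · have := congrFun hf 1
    rw [hb] at this
    exact this

end Orthonormal

namespace IsLadderFamily.IsExtremal

variable {H : Type*} [NormedAddCommGroup H] [InnerProductSpace ℂ H]
  {H' : Type*} [NormedAddCommGroup H'] [InnerProductSpace ℂ H']
  {n : ℕ} {f : H} {v : ℕ → ℤˣ → H} {f' : H'} {v' : ℕ → ℤˣ → H'}

/-- An extremal family is determined by two consecutive rungs. -/
theorem map_eq (h : IsExtremal n f v) (h' : IsExtremal n f' v') (hn : 4 ≤ n) (T : H →ₗ[ℂ] H')
    (h1 : ∀ b, T (v 1 b) = v' 1 b) (h2 : ∀ b, T (v 2 b) = v' 2 b) :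
    T f = f' ∧ ∀ e b, T (v e b) = v' e b := by
  have hn2 : 2 ≤ n := by omega
  have hS1 : T (ladderSum v 1) = ladderSum v' 1 := by simp [ladderSum, h1]
  have hS2 : T (ladderSum v 2) = ladderSum v' 2 := by simp [ladderSum, h2]
  have hD1 : T (ladderDiff v 1) = ladderDiff v' 1 := by simp [ladderDiff, h1]
  have hD2 : T (ladderDiff v 2) = ladderDiff v' 2 := by simp [ladderDiff, h2]
  have hT : T f = f' := by
    have e1 : ladderSum v 2 = _ := h.sum_succ hn2 1
    have e2 : ladderSum v' 2 = _ := h'.sum_succ hn2 1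
    have hne : ((1 + Real.cos (Real.pi / n) : ℝ) : ℂ) ≠ 0 :=
      Complex.ofReal_ne_zero.2 (one_add_cos_pos hn2).ne'
    rw [eq_sub_iff_add_eq] at e1 e2
    apply smul_right_injective _ hne
    simp only
    rw [← e2, ← map_smul, ← e1, map_add, hS1, hS2]
  have hS : ∀ e, T (ladderSum v (e + 1)) = ladderSum v' (e + 1) := fun e => by
    induction e with
    | zero => exact hS1
    | succ e ih => rw [h.sum_succ hn2, h'.sum_succ hn2, map_sub, map_smul, hT, ih]
  have hS' : ∀ e, T (ladderSum v e) = ladderSum v' e := fun e => by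
    rw [← h.sum_add_two hn2, ← h'.sum_add_two hn2]; exact hS (e + 1)
  have hs : (Real.sin (Real.pi / n) : ℂ) ≠ 0 := Complex.ofReal_ne_zero.2 (sin_pi_div_pos hn2).ne'
  -- Recovering `d_0` and the quarter vector from `d_1` and `d_2` is a linear system with
  -- determinant `sin(2t - t)`, `t = π/n`.
  have hsin : Real.sin (Real.pi / n) =
      Real.sin ((2 : ℕ) * (Real.pi / n)) * Real.cos ((1 : ℕ) * (Real.pi / n)) -
      Real.cos ((2 : ℕ) * (Real.pi / n)) * Real.sin ((1 : ℕ) * (Real.pi / n)) := by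
    rw [← Real.sin_sub]; congr 1; push_cast; ring
  have hsin' : (Real.sin (Real.pi / n) : ℂ) =
      Real.sin ((2 : ℕ) * (Real.pi / n)) * Real.cos ((1 : ℕ) * (Real.pi / n)) -
      Real.cos ((2 : ℕ) * (Real.pi / n)) * Real.sin ((1 : ℕ) * (Real.pi / n)) := by
    rw [hsin]; push_cast; ring
  rw [h.diff_eq' hn2, h'.diff_eq' hn2, map_add, map_smul, map_smul] at hD1 hD2
  have hD0 : T (ladderDiff v 0) = ladderDiff v' 0 := by
    apply smul_right_injective _ hs
    simp only [hsin']
    linear_combination (norm := module) (Real.sin ((2 : ℕ) * (Real.pi / n)) : ℂ) • hD1 -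
      (Real.sin ((1 : ℕ) * (Real.pi / n)) : ℂ) • hD2
  have hq : T (quarter n v) = quarter n v' := by
    apply smul_right_injective _ hs
    simp only [hsin']
    linear_combination (norm := module) (Real.cos ((1 : ℕ) * (Real.pi / n)) : ℂ) • hD2 -
      (Real.cos ((2 : ℕ) * (Real.pi / n)) : ℂ) • hD1
  refine ⟨hT, fun e b => ?_⟩
  rw [eq_ladderSum_add_ladderDiff v, eq_ladderSum_add_ladderDiff v', map_smul, map_add, map_smul,
    hS', h.diff_eq' hn2, h'.diff_eq' hn2, map_add, map_smul, map_smul, hD0, hq]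

end IsLadderFamily.IsExtremal

/-- An extremal family in a tensor product which consists of the projections of the base vector to
product vectors, where consecutive rungs alternately share Bob's and Alice's vectors. -/
structure IsProductExtremal {HA : Type*} {HB : Type*} [NormedAddCommGroup HA]
    [InnerProductSpace ℂ HA] [NormedAddCommGroup HB] [InnerProductSpace ℂ HB] (n : ℕ)
    (f : HA ⊗[ℂ] HB) (v : ℕ → ℤˣ → HA ⊗[ℂ] HB) (A : ℕ → ℤˣ → HA) (B : ℕ → ℤˣ → HB) : Prop where
  isExtremal : IsLadderFamily.IsExtremal n f v
  norm_left : ∀ k b, ‖A k b‖ = 1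
  norm_right : ∀ k b, ‖B k b‖ = 1
  eq_smul : ∀ e b, v e b = inner ℂ (A ((e + 1) / 2) b ⊗ₜ[ℂ] B (e / 2) b) f •
    (A ((e + 1) / 2) b ⊗ₜ[ℂ] B (e / 2) b)

namespace IsProductExtremal

open IsLadderFamily IsLadderFamily.IsExtremal

variable {HA : Type*} {HB : Type*} [NormedAddCommGroup HA] [InnerProductSpace ℂ HA]
  [NormedAddCommGroup HB] [InnerProductSpace ℂ HB] {n : ℕ}
  {f : HA ⊗[ℂ] HB} {v : ℕ → ℤˣ → HA ⊗[ℂ] HB} {A : ℕ → ℤˣ → HA} {B : ℕ → ℤˣ → HB}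

theorem exists_eq_smul (h : IsProductExtremal n f v A B) (hn : 4 ≤ n) (hev : Even n) (e : ℕ)
    (b : ℤˣ) : ∃ s : ℂ, s ≠ 0 ∧ v e b = s • (A ((e + 1) / 2) b ⊗ₜ[ℂ] B (e / 2) b) := by
  refine ⟨_, fun hs => ?_, h.eq_smul e b⟩
  have h1 := h.isExtremal.inner_eq hn hev e e b b
  rw [h.eq_smul e b, hs, zero_smul, inner_zero_left, Int.units_mul_self, if_pos rfl, sub_self,
    Real.cos_zero] at h1
  have h2 := one_add_cos_pos (n := n) (by omega)
  have h3 := Complex.ofReal_eq_zero.1 h1.symm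
  push_cast at h3
  linarith

/-- The inner product is a positive multiple of `1 - cos(2π/n)`. It serves to exclude orthogonality
of local factors. -/
theorem inner_add_two_ne_zero (h : IsProductExtremal n f v A B) (hn : 4 ≤ n) (hev : Even n)
    (e : ℕ) (b : ℤˣ) : inner ℂ (v e b) (v (e + 2) (-b)) ≠ 0 := by
  rw [h.isExtremal.inner_eq hn hev, if_pos (by omega), mul_neg, Int.units_mul_self,
    Complex.ofReal_ne_zero]
  have h1 := sin_pi_div_pos (n := n) (by omega)
  have h2 := one_add_cos_pos (n := n) (by omega)
  rw [show (e : ℝ) * (Real.pi / n) - (e + 2 : ℕ) * (Real.pi / n) = -(2 * (Real.pi / n)) by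
    push_cast; ring, Real.cos_neg, Real.cos_two_mul, Real.cos_sq']
  refine mul_ne_zero (by positivity) ?_
  push_cast
  have : 0 < Real.sin (Real.pi / n) ^ 2 := by positivity
  intro h
  linarith

/-- Rungs `2k` and `2k + 1` share Bob's pair, so `link` makes a product of an Alice factor and the
desired factor vanish. The Alice factor also divides the nonzero product of rungs `2k` and `2k + 2`.
-/
theorem inner_right_eq_zero (h : IsProductExtremal n f v A B) (hn : 4 ≤ n) (hev : Even n) (k : ℕ) :
    inner ℂ (B k 1) (B k (-1)) = 0 := by
  obtain ⟨s, hs, h1⟩ := h.exists_eq_smul hn hev (2 * k) 1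
  obtain ⟨s', hs', h2⟩ := h.exists_eq_smul hn hev (2 * k + 1) (-1)
  obtain ⟨s'', hs'', h3⟩ := h.exists_eq_smul hn hev (2 * k + 2) (-1)
  have h4 := h.isExtremal.link (2 * k) 1
  have h5 := h.inner_add_two_ne_zero hn hev (2 * k) 1
  rw [show (2 * k + 1) / 2 = k by omega, show 2 * k / 2 = k by omega] at h1
  rw [show (2 * k + 1 + 1) / 2 = k + 1 by omega, show (2 * k + 1) / 2 = k by omega] at h2
  rw [show (2 * k + 2 + 1) / 2 = k + 1 by omega, show (2 * k + 2) / 2 = k + 1 by omega] at h3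
  rw [h1, h2, inner_smul_left (E := HA ⊗[ℂ] HB), inner_smul_right (E := HA ⊗[ℂ] HB),
    TensorProduct.inner_tmul] at h4
  rw [h1, h3, inner_smul_left (E := HA ⊗[ℂ] HB), inner_smul_right (E := HA ⊗[ℂ] HB),
    TensorProduct.inner_tmul] at h5
  simp only [ne_eq, mul_eq_zero, map_eq_zero, hs, hs', hs'', false_or, not_or] at h4 h5
  exact h4.resolve_left h5.1

theorem inner_left_eq_zero (h : IsProductExtremal n f v A B) (hn : 4 ≤ n) (hev : Even n) (k : ℕ) :
    inner ℂ (A (k + 1) 1) (A (k + 1) (-1)) = 0 := by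
  obtain ⟨s, hs, h1⟩ := h.exists_eq_smul hn hev (2 * k + 1) 1
  obtain ⟨s', hs', h2⟩ := h.exists_eq_smul hn hev (2 * k + 1 + 1) (-1)
  obtain ⟨s'', hs'', h3⟩ := h.exists_eq_smul hn hev (2 * k + 1 + 2) (-1)
  have h4 := h.isExtremal.link (2 * k + 1) 1
  have h5 := h.inner_add_two_ne_zero hn hev (2 * k + 1) 1
  rw [show (2 * k + 1 + 1) / 2 = k + 1 by omega, show (2 * k + 1) / 2 = k by omega] at h1
  rw [show (2 * k + 1 + 1 + 1) / 2 = k + 1 by omega,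
    show (2 * k + 1 + 1) / 2 = k + 1 by omega] at h2
  rw [show (2 * k + 1 + 2 + 1) / 2 = k + 2 by omega,
    show (2 * k + 1 + 2) / 2 = k + 1 by omega] at h3
  rw [h1, h2, inner_smul_left (E := HA ⊗[ℂ] HB), inner_smul_right (E := HA ⊗[ℂ] HB),
    TensorProduct.inner_tmul] at h4
  rw [h1, h3, inner_smul_left (E := HA ⊗[ℂ] HB), inner_smul_right (E := HA ⊗[ℂ] HB),
    TensorProduct.inner_tmul] at h5
  simp only [ne_eq, mul_eq_zero, map_eq_zero, hs, hs', hs'', false_or, not_or] at h4 h5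
  exact h4.resolve_right h5.2

/-- The sums of rungs `3` and `1` agree. Contracting with `A 2 b` leaves only `B 1 b` on one side,
as Alice's pair is orthogonal, and a combination of Bob's first pair on the other. -/
theorem exists_right_eq (h : IsProductExtremal n f v A B) (hn : 4 ≤ n) (hev : Even n) (b : ℤˣ) :
    ∃ x y : ℂ, B 1 b = x • B 0 1 + y • B 0 (-1) := by
  obtain ⟨s, hs, h1⟩ := h.exists_eq_smul hn hev 3 1
  obtain ⟨s', hs', h2⟩ := h.exists_eq_smul hn hev 3 (-1)
  obtain ⟨t, -, h3⟩ := h.exists_eq_smul hn hev 1 1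
  obtain ⟨t', -, h4⟩ := h.exists_eq_smul hn hev 1 (-1)
  have h5 := h.isExtremal.sum_add_two (by omega) 1
  simp only [ladderSum, Nat.reduceAdd, h1, h2, h3, h4, Nat.reduceDiv] at h5
  have h6 := h.inner_left_eq_zero hn hev 1
  have h7 := inner_eq_zero_symm.1 h6
  have h8 := congrArg (innerContractLeft (A 2 b)) h5
  simp only [map_add, map_smul, innerContractLeft_tmul, smul_smul] at h8
  rcases Int.units_eq_one_or b with rfl | rfl
  · rw [h6, inner_self_eq_norm_sq_to_K, h.norm_left] at h8
    simp only [Complex.coe_algebraMap, Complex.ofReal_one, one_pow, mul_one, mul_zero, zero_smul,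
      add_zero] at h8
    refine ⟨s⁻¹ * (t * inner ℂ (A 2 1) (A 1 1)), s⁻¹ * (t' * inner ℂ (A 2 1) (A 1 (-1))), ?_⟩
    rw [mul_smul s⁻¹, mul_smul s⁻¹, ← smul_add, ← h8, inv_smul_smul₀ hs]
  · rw [h7, inner_self_eq_norm_sq_to_K, h.norm_left] at h8
    simp only [Complex.coe_algebraMap, Complex.ofReal_one, one_pow, mul_one, mul_zero, zero_smul,
      zero_add] at h8
    refine ⟨s'⁻¹ * (t * inner ℂ (A 2 (-1)) (A 1 1)),
      s'⁻¹ * (t' * inner ℂ (A 2 (-1)) (A 1 (-1))), ?_⟩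
    rw [mul_smul s'⁻¹, mul_smul s'⁻¹, ← smul_add, ← h8, inv_smul_smul₀ hs']

end IsProductExtremal

namespace IsProductExtremal

open IsLadderFamily IsLadderFamily.IsExtremal

variable {HA : Type*} {HB : Type*} [NormedAddCommGroup HA] [InnerProductSpace ℂ HA]
  [NormedAddCommGroup HB] [InnerProductSpace ℂ HB] {n : ℕ}
  {f : HA ⊗[ℂ] HB} {v : ℕ → ℤˣ → HA ⊗[ℂ] HB} {A : ℕ → ℤˣ → HA} {B : ℕ → ℤˣ → HB}

theorem exists_norm_eq (h : IsLadderFamily.IsExtremal n f v) (hn : 4 ≤ n) (hev : Even n) :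
    ∃ r : ℝ, 0 < r ∧ (∀ e b, ‖v e b‖ = r) ∧ ∀ e b,
      inner ℂ (v e b) (v (e + 1) b) = ((r : ℂ) * r * Real.cos (Real.pi / n) : ℂ) := by
  have h2 := one_add_cos_pos (n := n) (by omega)
  refine ⟨Real.sqrt ((1 + Real.cos (Real.pi / n)) / 4), by positivity, fun e b => ?_, fun e b => ?_⟩
  · rw [eq_comm, Real.sqrt_eq_iff_eq_sq (by positivity) (norm_nonneg _)]
    apply Complex.ofReal_injective
    have h1 := h.inner_eq hn hev e e b b
    rw [inner_self_eq_norm_sq_to_K (E := HA ⊗[ℂ] HB), if_pos rfl, sub_self, Real.cos_zero,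
      Int.units_mul_self] at h1
    rw [Complex.ofReal_pow]
    refine Eq.trans ?_ h1.symm
    push_cast
    ring
  · rw [h.inner_eq hn hev, if_neg (by omega), Int.units_mul_self, ← Complex.ofReal_mul,
      Real.mul_self_sqrt (by positivity),
      show (e : ℝ) * (Real.pi / n) - (e + 1 : ℕ) * (Real.pi / n) = -(Real.pi / n) by
        push_cast; ring, Real.cos_neg]
    push_cast
    ring

/-- The two rungs which share the second vectors of Alice, in a common orthonormal form. -/
theorem exists_normal_form (h : IsProductExtremal n f v A B) (hn : 4 ≤ n) (hev : Even n) {r : ℝ}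
    (hr : 0 < r) (hnorm : ∀ e b, ‖v e b‖ = r) (hinner : ∀ e b,
      inner ℂ (v e b) (v (e + 1) b) = ((r : ℂ) * r * Real.cos (Real.pi / n) : ℂ)) :
    ∃ a₀ a₁ : HA, ∃ b₀ b₁ : HB, Orthonormal ℂ ![a₀, a₁] ∧ Orthonormal ℂ ![b₀, b₁] ∧
      v 1 1 = (r : ℂ) • (a₀ ⊗ₜ[ℂ] b₀) ∧ v 1 (-1) = (r : ℂ) • (a₁ ⊗ₜ[ℂ] b₁) ∧
      v 2 1 = (r : ℂ) • (a₀ ⊗ₜ[ℂ]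
        ((Real.cos (Real.pi / n) : ℂ) • b₀ + (Real.sin (Real.pi / n) : ℂ) • b₁)) ∧
      v 2 (-1) = (r : ℂ) • (a₁ ⊗ₜ[ℂ]
        ((Real.cos (Real.pi / n) : ℂ) • b₁ - (Real.sin (Real.pi / n) : ℂ) • b₀)) := by
  obtain ⟨s, hs, hp1⟩ := h.exists_eq_smul hn hev 1 1
  obtain ⟨s', hs', hm1⟩ := h.exists_eq_smul hn hev 1 (-1)
  obtain ⟨t, ht, hp2⟩ := h.exists_eq_smul hn hev 2 1
  obtain ⟨t', ht', hm2⟩ := h.exists_eq_smul hn hev 2 (-1)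
  simp only [Nat.reduceAdd, Nat.reduceDiv] at hp1 hm1 hp2 hm2
  obtain ⟨x, y, hxy⟩ := h.exists_right_eq hn hev 1
  obtain ⟨x', y', hxy'⟩ := h.exists_right_eq hn hev (-1)
  have hA : inner ℂ (A 1 1) (A 1 (-1)) = 0 := h.inner_left_eq_zero hn hev 0
  have hB0 := h.inner_right_eq_zero hn hev 0
  have hB1 := h.inner_right_eq_zero hn hev 1
  have hrc : (r : ℂ) ≠ 0 := Complex.ofReal_ne_zero.2 hr.ne'
  have hsin : (Real.sin (Real.pi / n) : ℂ) ≠ 0 :=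
    Complex.ofReal_ne_zero.2 (sin_pi_div_pos (by omega)).ne'
  have hcs : (Real.sin (Real.pi / n) : ℂ) ^ 2 + (Real.cos (Real.pi / n) : ℂ) ^ 2 = 1 := by
    exact_mod_cast Real.sin_sq_add_cos_sq (Real.pi / n)
  set c : ℂ := (Real.cos (Real.pi / n) : ℂ) with hc
  set σ : ℂ := (Real.sin (Real.pi / n) : ℂ) with hσ
  have hcc : (starRingEnd ℂ) c = c := Complex.conj_ofReal _
  have hσc : (starRingEnd ℂ) σ = σ := Complex.conj_ofReal _
  -- the vectors of the first end
  set b₀ := B 0 1 with hb₀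
  -- The coefficients of the product vectors are absorbed into `a₀` and `w`, so that both rungs have
  -- the common factor `r`.
  obtain ⟨a₀, ha₀⟩ : ∃ z, z = ((r : ℂ)⁻¹ * s) • A 1 1 := ⟨_, rfl⟩
  obtain ⟨w, hw⟩ : ∃ z, z = (s⁻¹ * t) • B 1 1 := ⟨_, rfl⟩
  have e1 : v 1 1 = (r : ℂ) • (a₀ ⊗ₜ[ℂ] b₀) := by
    rw [hp1, ha₀, ← TensorProduct.smul_tmul', smul_smul, mul_inv_cancel_left₀ hrc]
  have e2 : v 2 1 = (r : ℂ) • (a₀ ⊗ₜ[ℂ] w) := by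
    rw [hp2, ha₀, hw, ← TensorProduct.smul_tmul', TensorProduct.tmul_smul, smul_smul, smul_smul]
    congr 1
    field_simp
  have hb₀n : ‖b₀‖ = 1 := h.norm_right 0 1
  have norm_of : ∀ (e : ℕ) (b : ℤˣ) (u : HA) (z : HB), v e b = (r : ℂ) • (u ⊗ₜ[ℂ] z) →
      ‖u‖ * ‖z‖ = 1 := fun e b u z he => by
    have h1 := hnorm e b
    rw [he, norm_smul, Complex.norm_real, Real.norm_eq_abs, abs_of_pos hr,
      TensorProduct.norm_tmul] at h1
    exact mul_left_cancel₀ hr.ne' (h1.trans (mul_one r).symm)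
  have ha₀n : ‖a₀‖ = 1 := by simpa [hb₀n] using norm_of 1 1 _ _ e1
  have hwn : ‖w‖ = 1 := by simpa [ha₀n] using norm_of 2 1 _ _ e2
  have inner_of : ∀ (b : ℤˣ) (u : HA) (z z' : HB), v 1 b = (r : ℂ) • (u ⊗ₜ[ℂ] z) →
      v 2 b = (r : ℂ) • (u ⊗ₜ[ℂ] z') → ‖u‖ = 1 → inner ℂ z z' = c := fun b u z z' hz hz' hu => by
    have h1 := hinner 1 b
    rw [show 1 + 1 = 2 from rfl, hz, hz', inner_smul_left (E := HA ⊗[ℂ] HB),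
      inner_smul_right (E := HA ⊗[ℂ] HB), TensorProduct.inner_tmul, inner_self_eq_norm_sq_to_K,
      hu, Complex.conj_ofReal] at h1
    simp only [Complex.coe_algebraMap, Complex.ofReal_one, one_pow, one_mul] at h1
    rw [← mul_assoc] at h1
    exact mul_left_cancel₀ (mul_ne_zero hrc hrc) h1
  have hb₀w : inner ℂ b₀ w = c := inner_of 1 _ _ _ e1 e2 ha₀n
  have hb₀b₀ : inner ℂ b₀ b₀ = (1 : ℂ) := by rw [inner_self_eq_norm_sq_to_K, hb₀n]; simp
  have hww : inner ℂ w w = (1 : ℂ) := by rw [inner_self_eq_norm_sq_to_K, hwn]; simp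
  have hwb₀ : inner ℂ w b₀ = c := by rw [← inner_conj_symm, hb₀w, hcc]
  -- Gram–Schmidt applied to `b₀`, `w`, whose inner product is `cos(π/n)`.
  obtain ⟨b₁, hb₁⟩ : ∃ z, z = σ⁻¹ • (w - c • b₀) := ⟨_, rfl⟩
  have hwb : w = c • b₀ + σ • b₁ := by
    rw [hb₁, smul_inv_smul₀ hsin]; abel
  have hb₀b₁ : inner ℂ b₀ b₁ = 0 := by
    rw [hb₁, inner_smul_right, inner_sub_right, inner_smul_right, hb₀w, hb₀b₀]; ring
  have hb₁b₁ : inner ℂ b₁ b₁ = (1 : ℂ) := by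
    rw [hb₁, inner_smul_right, inner_smul_left, inner_sub_right, inner_sub_left, inner_sub_left,
      inner_smul_left, inner_smul_right, inner_smul_right, inner_smul_left, hb₀w, hb₀b₀, hwb₀, hww,
      map_inv₀, hσc, hcc]
    field_simp
    linear_combination -hcs
  have hb₁n : ‖b₁‖ = 1 := by
    rw [inner_self_eq_norm_sq_to_K] at hb₁b₁
    have h2 : ‖b₁‖ ^ 2 = 1 := Complex.ofReal_injective (by simpa using hb₁b₁)
    exact (pow_eq_one_iff_of_nonneg (norm_nonneg _) two_ne_zero).1 h2
  -- Bob's vector at the second end of the first rung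
  have hB0b : ∃ κ : ℂ, B 0 (-1) = κ • b₁ := by
    -- As `w` lies in the span of Bob's orthogonal first pair, its component orthogonal to `b₀` is a
    -- multiple of `B 0 (-1)`.
    have h1 : w = (s⁻¹ * t * x) • b₀ + (s⁻¹ * t * y) • B 0 (-1) := by
      rw [hw, hxy, smul_add, smul_smul, smul_smul]
    have h2 : s⁻¹ * t * x = c := by
      rw [← hb₀w, h1, inner_add_right, inner_smul_right, inner_smul_right, hb₀b₀, hB0]; ring
    have h3 : σ • b₁ = (s⁻¹ * t * y) • B 0 (-1) := by
      rw [h2, hwb] at h1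
      exact add_left_cancel h1
    have h4 : s⁻¹ * t * y ≠ 0 := fun h4 => by
      rw [h4, zero_smul, smul_eq_zero] at h3
      rcases h3 with h3 | h3
      · exact hsin h3
      · rw [h3, norm_zero] at hb₁n; exact zero_ne_one hb₁n
    refine ⟨(s⁻¹ * t * y)⁻¹ * σ, ?_⟩
    rw [mul_smul, h3, inv_smul_smul₀ h4]
  obtain ⟨κ, hκ⟩ := hB0b
  have hκ0 : κ ≠ 0 := fun h0 => by
    have := h.norm_right 0 (-1)
    rw [hκ, h0, zero_smul, norm_zero] at this
    exact zero_ne_one this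
  obtain ⟨a₁, ha₁⟩ : ∃ z, z = ((r : ℂ)⁻¹ * s' * κ) • A 1 (-1) := ⟨_, rfl⟩
  obtain ⟨w', hw'⟩ : ∃ z, z = (s'⁻¹ * κ⁻¹ * t') • B 1 (-1) := ⟨_, rfl⟩
  have e3 : v 1 (-1) = (r : ℂ) • (a₁ ⊗ₜ[ℂ] b₁) := by
    rw [hm1, hκ, ha₁, ← TensorProduct.smul_tmul', TensorProduct.tmul_smul, smul_smul, smul_smul]
    congr 1
    field_simp
  have e4 : v 2 (-1) = (r : ℂ) • (a₁ ⊗ₜ[ℂ] w') := by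
    rw [hm2, ha₁, hw', ← TensorProduct.smul_tmul', TensorProduct.tmul_smul, smul_smul, smul_smul]
    congr 1
    field_simp
  have ha₁n : ‖a₁‖ = 1 := by simpa [hb₁n] using norm_of 1 (-1) _ _ e3
  have hb₁w' : inner ℂ b₁ w' = c := inner_of (-1) _ _ _ e3 e4 ha₁n
  -- The coefficient of `b₁` comes from the inner product of rungs `1` and `2`; that of `b₀` is then
  -- forced by `w ⊥ w'`, using `cos(π/n) ≠ 0`.
  have hw'b : w' = c • b₁ - σ • b₀ := by
    have h1 : w' = (s'⁻¹ * κ⁻¹ * t' * x') • b₀ + (s'⁻¹ * κ⁻¹ * t' * y' * κ) • b₁ := by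
      rw [hw', hxy', hκ, smul_add, smul_smul, smul_smul, smul_smul]
    have hb₁b₀ : inner ℂ b₁ b₀ = (0 : ℂ) := inner_eq_zero_symm.1 hb₀b₁
    have h2 : s'⁻¹ * κ⁻¹ * t' * y' * κ = c := by
      rw [← hb₁w', h1, inner_add_right, inner_smul_right, inner_smul_right, hb₁b₀, hb₁b₁]; ring
    have h3 : inner ℂ w w' = 0 := by
      rw [hw, hw', inner_smul_left, inner_smul_right, hB1]; ring
    rw [h1, h2, hwb, inner_add_left, inner_add_right, inner_add_right, inner_smul_left,
      inner_smul_left, inner_smul_left, inner_smul_left, inner_smul_right, inner_smul_right,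
      inner_smul_right, inner_smul_right, hb₀b₀, hb₀b₁, hb₁b₁, hb₁b₀, hcc, hσc] at h3
    have hc0 : c ≠ 0 := Complex.ofReal_ne_zero.2 (cos_pi_div_pos hn).ne'
    have h4 : s'⁻¹ * κ⁻¹ * t' * x' = -σ := by
      apply mul_left_cancel₀ hc0
      linear_combination h3
    rw [h1, h2, h4]
    module
  refine ⟨a₀, a₁, b₀, b₁, orthonormal_pair_iff.2 ⟨ha₀n, ha₁n, ?_⟩,
    orthonormal_pair_iff.2 ⟨hb₀n, hb₁n, hb₀b₁⟩, e1, e3,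
    by rw [e2, hwb], by rw [e4, hw'b]⟩
  rw [ha₀, ha₁, inner_smul_left, inner_smul_right, hA, mul_zero, mul_zero]

end IsProductExtremal

/-! ### Self-testing -/

section LocalVectors

variable {H : Type*} [NormedAddCommGroup H] [InnerProductSpace ℂ H]
  {H' : Type*} [NormedAddCommGroup H'] [InnerProductSpace ℂ H']

/-- The norms force `κ` to be a phase, and a rank-one projection does not see the phase of its
vector. -/
theorem rankOne_comp_of_map_eq_smul (V : H →ₗᵢ[ℂ] H') {α : H} {α' : H'} {κ : ℂ} (hα : ‖α‖ = 1)
    (hα' : ‖α'‖ = 1) (h : V α = κ • α') :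
    (InnerProductSpace.rankOne ℂ α' α').toLinearMap ∘ₗ V.toLinearMap =
      V.toLinearMap ∘ₗ (InnerProductSpace.rankOne ℂ α α).toLinearMap := by
  have hκ : ‖κ‖ = 1 := by
    have := congrArg norm h
    rwa [V.norm_map, hα, norm_smul, hα', mul_one, eq_comm] at this
  have hκ0 : κ ≠ 0 := norm_ne_zero_iff.1 (by rw [hκ]; exact one_ne_zero)
  have h1 : (starRingEnd ℂ) κ * κ = 1 := by
    rw [← Complex.normSq_eq_conj_mul_self, Complex.normSq_eq_norm_sq, hκ]; simp
  have h2 : α' = (starRingEnd ℂ) κ • V α := by rw [h, smul_smul, h1, one_smul]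
  ext x
  simp only [LinearMap.comp_apply, ContinuousLinearMap.coe_coe, LinearIsometry.coe_toLinearMap,
    InnerProductSpace.rankOne_apply, map_smul]
  rw [h2, inner_smul_left, V.inner_map_map, smul_smul, Complex.conj_conj,
    mul_right_comm, mul_comm κ, h1, one_mul]

end LocalVectors

namespace BellRealization

variable {N : ℕ} [NeZero N]

section Unrolled

variable {HA : Type*} {HB : Type*} [NormedAddCommGroup HA] [InnerProductSpace ℂ HA]
  [NormedAddCommGroup HB] [InnerProductSpace ℂ HB]

theorem exists_isProductExtremal (S : BellRealization N HA HB) (hS : S.IsRankOne)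
    (hext : IsLadderFamily.IsExtremal (2 * N) S.state
      fun e b => chainedVec S (some (chainEv N e b))) :
    ∃ A : ℕ → ℤˣ → HA, ∃ B : ℕ → ℤˣ → HB,
      IsProductExtremal (2 * N) S.state (fun e b => chainedVec S (some (chainEv N e b))) A B ∧
      (∀ (x : Fin N) a, S.projA x a = (InnerProductSpace.rankOne ℂ (A x a) (A x a)).toLinearMap) ∧
      ∀ (y : Fin N) b, S.projB y b =
        (InnerProductSpace.rankOne ℂ (B y b) (B y b)).toLinearMap := by
  choose α hα hA using fun x a => exists_eq_rankOne (S.projA_isProj x a) (hS.1 x a)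
  choose β hβ hB using fun y b => exists_eq_rankOne (S.projB_isProj y b) (hS.2 y b)
  -- Settings are continued periodically, with the outcomes exchanged after each turn, in accordance
  -- with `chainEv`.
  refine ⟨fun k b => α ⟨k % N, Nat.mod_lt _ (NeZero.pos N)⟩ ((-1) ^ (k / N) * b),
    fun k b => β ⟨k % N, Nat.mod_lt _ (NeZero.pos N)⟩ ((-1) ^ (k / N) * b),
    ⟨hext, fun _ _ => hα _ _, fun _ _ => hβ _ _, fun e b => ?_⟩, fun x a => ?_, fun y b => ?_⟩
  · rw [chainedVec, eventVec, chainA_chainEv, chainB_chainEv, snd_chainEv, outB_chainEv, hA, hB,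
      map_rankOne_self]
  · simp only [Nat.mod_eq_of_lt x.isLt, Nat.div_eq_of_lt x.isLt, pow_zero, one_mul, Fin.eta, hA]
  · simp only [Nat.mod_eq_of_lt y.isLt, Nat.div_eq_of_lt y.isLt, pow_zero, one_mul, Fin.eta, hB]

end Unrolled

variable {HA : Type*} {HB : Type*} [NormedAddCommGroup HA] [InnerProductSpace ℂ HA]
  [NormedAddCommGroup HB] [InnerProductSpace ℂ HB]

/-- Two extremal rank-one realizations, one of which is on qubits, are related by local
isometries. -/
theorem exists_linearIsometry (hN : 2 ≤ N) (R : BellRealization N Qubit Qubit)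
    (hR : R.IsRankOne)
    (hRext : IsLadderFamily.IsExtremal (2 * N) R.state
      fun e b => chainedVec R (some (chainEv N e b)))
    (S : BellRealization N HA HB) (hS : S.IsRankOne)
    (hSext : IsLadderFamily.IsExtremal (2 * N) S.state
      fun e b => chainedVec S (some (chainEv N e b))) :
    ∃ (VA : Qubit →ₗᵢ[ℂ] HA) (VB : Qubit →ₗᵢ[ℂ] HB),
      TensorProduct.map VA.toLinearMap VB.toLinearMap R.state = S.state ∧
      ∀ (x y : Fin N) (a b : ℤˣ),
        TensorProduct.map VA.toLinearMap VB.toLinearMap (R.eventVec x y a b) =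
          S.eventVec x y a b := by
  have hn : 4 ≤ 2 * N := by omega
  have hev := even_two_mul N
  obtain ⟨A, B, hRp, hRA, hRB⟩ := R.exists_isProductExtremal hR hRext
  obtain ⟨A', B', hSp, hSA, hSB⟩ := S.exists_isProductExtremal hS hSext
  obtain ⟨r, hr, hRn, hRi⟩ := IsProductExtremal.exists_norm_eq hRext hn hev
  obtain ⟨r', hr', hSn, hSi⟩ := IsProductExtremal.exists_norm_eq hSext hn hev
  obtain rfl : r = r' := by
    have h1 := hRext.inner_eq hn hev 0 0 1 1
    rw [← hSext.inner_eq hn hev 0 0 1 1, inner_self_eq_norm_sq_to_K (E := Qubit ⊗[ℂ] Qubit),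
      inner_self_eq_norm_sq_to_K (E := HA ⊗[ℂ] HB), hRn, hSn] at h1
    have h2 : r ^ 2 = r' ^ 2 := Complex.ofReal_injective (by simpa using h1)
    exact (pow_left_inj₀ hr.le hr'.le two_ne_zero).1 h2
  obtain ⟨a₀, a₁, b₀, b₁, ha, hb, h1, h2, h3, h4⟩ := hRp.exists_normal_form hn hev hr hRn hRi
  obtain ⟨a₀', a₁', b₀', b₁', ha', hb', h1', h2', h3', h4'⟩ :=
    hSp.exists_normal_form hn hev hr hSn hSi
  obtain ⟨VA, hVA₀, hVA₁⟩ := exists_linearIsometry_qubit ha ha'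
  obtain ⟨VB, hVB₀, hVB₁⟩ := exists_linearIsometry_qubit hb hb'
  obtain ⟨hst, hmap⟩ := hRext.map_eq hSext hn (TensorProduct.map VA.toLinearMap VB.toLinearMap)
    (fun b => by
      rcases Int.units_eq_one_or b with rfl | rfl
      · rw [h1, h1', map_smul, TensorProduct.map_tmul]
        simp only [LinearIsometry.coe_toLinearMap, hVA₀, hVB₀]
      · rw [h2, h2', map_smul, TensorProduct.map_tmul]
        simp only [LinearIsometry.coe_toLinearMap, hVA₁, hVB₁])
    (fun b => by
      rcases Int.units_eq_one_or b with rfl | rfl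
      · rw [h3, h3', map_smul, TensorProduct.map_tmul]
        simp only [LinearIsometry.coe_toLinearMap, map_add, map_smul, hVA₀, hVB₀,
          hVB₁]
      · rw [h4, h4', map_smul, TensorProduct.map_tmul]
        simp only [LinearIsometry.coe_toLinearMap, map_sub, map_smul, hVA₁, hVB₀,
          hVB₁])
  -- Rung `2k` pairs Alice's and Bob's vectors of the same index `k`, so the even rungs reach all
  -- local vectors.
  have hpar : ∀ k b, ∃ κ : ℂ, VA (A k b) ⊗ₜ[ℂ] VB (B k b) = κ • (A' k b ⊗ₜ[ℂ] B' k b) :=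
    fun k b => by
      obtain ⟨s, hs, e1⟩ := hRp.exists_eq_smul hn hev (2 * k) b
      obtain ⟨s', -, e2⟩ := hSp.exists_eq_smul hn hev (2 * k) b
      have e3 := hmap (2 * k) b
      rw [e1, e2, map_smul, TensorProduct.map_tmul, show (2 * k + 1) / 2 = k by omega,
        show 2 * k / 2 = k by omega] at e3
      refine ⟨s⁻¹ * s', ?_⟩
      rw [mul_smul, ← e3, inv_smul_smul₀ hs]
      rfl
  have hparA : ∀ k b, ∃ κ : ℂ, VA (A k b) = κ • A' k b := fun k b => by
    obtain ⟨κ, hκ⟩ := hpar k b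
    have h := congrArg (innerContractRight (VB (B k b))) hκ
    rw [map_smul, innerContractRight_tmul, innerContractRight_tmul, inner_self_eq_norm_sq_to_K,
      VB.norm_map, hRp.norm_right, smul_smul] at h
    exact ⟨_, by simpa using h⟩
  have hparB : ∀ k b, ∃ κ : ℂ, VB (B k b) = κ • B' k b := fun k b => by
    obtain ⟨κ, hκ⟩ := hpar k b
    have h := congrArg (innerContractLeft (VA (A k b))) hκ
    rw [map_smul, innerContractLeft_tmul, innerContractLeft_tmul, inner_self_eq_norm_sq_to_K,
      VA.norm_map, hRp.norm_left, smul_smul] at h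
    exact ⟨_, by simpa using h⟩
  refine ⟨VA, VB, hst, fun x y a b => ?_⟩
  obtain ⟨κ, hκ⟩ := hparA x a
  obtain ⟨μ, hμ⟩ := hparB y b
  -- The isometries intertwine the local projections themselves; this covers all pairs of settings,
  -- also those that do not occur in the Bell expression.
  rw [eventVec, eventVec, ← hst, hRA, hRB, hSA, hSB, ← LinearMap.comp_apply,
    ← LinearMap.comp_apply, ← TensorProduct.map_comp, ← TensorProduct.map_comp,
    rankOne_comp_of_map_eq_smul VA (hRp.norm_left _ _) (hSp.norm_left _ _) hκ,
    rankOne_comp_of_map_eq_smul VB (hRp.norm_right _ _) (hSp.norm_right _ _) hμ]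

end BellRealization

/-- Completeness bounds the dimension by `1 + 1`, and the isometry bounds it from below; this is
what upgrades isometries to unitaries for measurements. -/
theorem finrank_eq_two_of_sum_eq_id {H : Type*} [NormedAddCommGroup H] [InnerProductSpace ℂ H]
    {P : ℤˣ → (H →ₗ[ℂ] H)} (hr : ∀ a, Module.finrank ℂ (LinearMap.range (P a)) = 1)
    (h : ∑ a, P a = LinearMap.id) (V : Qubit →ₗᵢ[ℂ] H) :
    FiniteDimensional ℂ H ∧ Module.finrank ℂ Qubit = Module.finrank ℂ H := by
  have hfin : ∀ a, FiniteDimensional ℂ (LinearMap.range (P a)) := fun a =>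
    Module.finite_of_finrank_pos (by rw [hr]; exact one_pos)
  have := hfin 1
  have := hfin (-1)
  have htop : LinearMap.range (P 1) ⊔ LinearMap.range (P (-1)) = ⊤ := by
    rw [eq_top_iff]
    intro x _
    have hx : P 1 x + P (-1) x = x := by
      rw [← LinearMap.add_apply, ← sum_units_int, h, LinearMap.id_apply]
    rw [← hx]
    exact Submodule.add_mem_sup ⟨x, rfl⟩ ⟨x, rfl⟩
  have hH : FiniteDimensional ℂ H := by
    have h1 : FiniteDimensional ℂ (⊤ : Submodule ℂ H) := by rw [← htop]; infer_instance
    exact Module.finite_def.2 ((Submodule.fg_top _).1 (Module.finite_def.1 h1))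
  refine ⟨hH, le_antisymm (LinearMap.finrank_le_finrank_of_injective V.injective) ?_⟩
  have h2 := Submodule.finrank_add_le_finrank_add_finrank (LinearMap.range (P 1))
    (LinearMap.range (P (-1)))
  rw [htop, hr, hr, finrank_top] at h2
  simpa using h2

/-! ### The main theorem -/

section Main

variable {N : ℕ} [NeZero N]

theorem isThetaOptimal_chainedReference (hN : 2 ≤ N) :
    IsThetaOptimal (chainedExclusivityGraph N) (chainedGram (chainedReference N)) :=
  ⟨(chainedReference_isMeasurement N).thetaFeasible, fun Y hY => by
    rw [thetaObjective_chainedReference N hN]; exact hY.thetaObjective_le⟩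

theorem IsThetaOptimal.thetaObjective_eq (hN : 2 ≤ N)
    {X : Matrix (Option (ChainEvent N)) (Option (ChainEvent N)) ℂ}
    (h : IsThetaOptimal (chainedExclusivityGraph N) X) :
    thetaObjective X = N * (1 + Real.cos (Real.pi / (2 * N))) :=
  le_antisymm h.1.thetaObjective_le (by
    rw [← thetaObjective_chainedReference N hN]
    exact h.2 _ (isThetaOptimal_chainedReference hN).1)

theorem exists_linearIsometry_of_thetaObjective_eq (hN : 2 ≤ N) {HA : Type*} {HB : Type*}
    [NormedAddCommGroup HA] [InnerProductSpace ℂ HA] [NormedAddCommGroup HB]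
    [InnerProductSpace ℂ HB] (S : BellRealization N HA HB) (hS : S.IsRankOne)
    (hfeas : ThetaFeasible (chainedExclusivityGraph N) (chainedGram S))
    (hval : thetaObjective (chainedGram S) = N * (1 + Real.cos (Real.pi / (2 * N)))) :
    ∃ (VA : Qubit →ₗᵢ[ℂ] HA) (VB : Qubit →ₗᵢ[ℂ] HB),
      TensorProduct.map VA.toLinearMap VB.toLinearMap (chainedReference N).state = S.state ∧
      ∀ (x y : Fin N) (a b : ℤˣ),
        TensorProduct.map VA.toLinearMap VB.toLinearMap
          ((chainedReference N).eventVec x y a b) = S.eventVec x y a b :=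
  have hfam : IsThetaFamily (chainedExclusivityGraph N) (chainedVec S) :=
    (thetaFeasible_iff_isThetaFamily fun _ _ => rfl).1 hfeas
  BellRealization.exists_linearIsometry hN _ (chainedReference_isRankOne N)
    ((chainedReference_isMeasurement N).isThetaFamily.isExtremal (fun _ _ => rfl)
      (thetaObjective_chainedReference N hN)) S hS
    (hfam.isExtremal (fun _ _ => rfl) hval)

end Main

theorem mainTheorem8 (N : ℕ) (hN : 2 ≤ N) :
    -- the standard realization consists of rank-one projective measurements and attains the value
    ((chainedReference N).IsMeasurement ∧ (chainedReference N).IsRankOne ∧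
      chainedBell (chainedReference N) = 2 * N * Real.cos (Real.pi / (2 * N))) ∧
    -- this value is the maximal quantum value
    (∀ (HA : Type u) (HB : Type v) [NormedAddCommGroup HA] [InnerProductSpace ℂ HA]
      [NormedAddCommGroup HB] [InnerProductSpace ℂ HB] (S : BellRealization N HA HB),
      S.IsMeasurement → chainedBell S ≤ 2 * N * Real.cos (Real.pi / (2 * N))) ∧
    -- self-testing from the maximal value, for rank-one projective measurements
    (∀ (HA : Type u) (HB : Type v) [NormedAddCommGroup HA] [InnerProductSpace ℂ HA]
      [NormedAddCommGroup HB] [InnerProductSpace ℂ HB] (S : BellRealization N HA HB),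
      S.IsMeasurement → S.IsRankOne →
      chainedBell S = 2 * N * Real.cos (Real.pi / (2 * N)) →
      ∃ (VA : Qubit ≃ₗᵢ[ℂ] HA) (VB : Qubit ≃ₗᵢ[ℂ] HB),
        TensorProduct.map (VA.toLinearEquiv : Qubit →ₗ[ℂ] HA) (VB.toLinearEquiv : Qubit →ₗ[ℂ] HB)
          (chainedReference N).state = S.state ∧
        ∀ (x y : Fin N) (a b : ℤˣ),
          TensorProduct.map (VA.toLinearEquiv : Qubit →ₗ[ℂ] HA) (VB.toLinearEquiv : Qubit →ₗ[ℂ] HB)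
            ((chainedReference N).eventVec x y a b) = S.eventVec x y a b) ∧
    -- the graph of exclusivity is the Moebius ladder, and the standard realization gives
    -- the unique maximizer of its theta program
    Nonempty (chainedExclusivityGraph N ≃g
      SimpleGraph.circulantGraph ({1, ((2 * N : ℕ) : ZMod (4 * N))} : Set (ZMod (4 * N)))) ∧
    (IsThetaOptimal (chainedExclusivityGraph N) (chainedGram (chainedReference N)) ∧
      thetaObjective (chainedGram (chainedReference N)) =
        N * (1 + Real.cos (Real.pi / (2 * N))) ∧
      ∀ X, IsThetaOptimal (chainedExclusivityGraph N) X →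
        X = chainedGram (chainedReference N)) ∧
    -- self-testing for rank-one projections, not assumed complete, that realize the maximizer
    (∀ (HA : Type u) (HB : Type v) [NormedAddCommGroup HA] [InnerProductSpace ℂ HA]
      [NormedAddCommGroup HB] [InnerProductSpace ℂ HB] (S : BellRealization N HA HB),
      S.IsRankOne → IsThetaOptimal (chainedExclusivityGraph N) (chainedGram S) →
      ∃ (VA : Qubit →ₗᵢ[ℂ] HA) (VB : Qubit →ₗᵢ[ℂ] HB),
        TensorProduct.map VA.toLinearMap VB.toLinearMap (chainedReference N).state = S.state ∧
        ∀ (x y : Fin N) (a b : ℤˣ),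
          TensorProduct.map VA.toLinearMap VB.toLinearMap
            ((chainedReference N).eventVec x y a b) = S.eventVec x y a b) := by
  have : NeZero N := ⟨by omega⟩
  refine ⟨⟨chainedReference_isMeasurement N, chainedReference_isRankOne N,
    chainedBell_chainedReference N hN⟩, ?_, ?_, nonempty_chainedExclusivityGraph_iso hN,
    ⟨isThetaOptimal_chainedReference hN, thetaObjective_chainedReference N hN, fun X hX =>
      hX.1.eq_of_thetaObjective_eq hN (hX.thetaObjective_eq hN)
        (isThetaOptimal_chainedReference hN).1 (thetaObjective_chainedReference N hN)⟩, ?_⟩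
  · intro HA HB _ _ _ _ S hS
    have h1 := hS.thetaFeasible.thetaObjective_le
    rw [hS.thetaObjective_eq] at h1
    linarith
  · intro HA HB _ _ _ _ S hS hSr hval
    obtain ⟨VA, VB, h1, h2⟩ := exists_linearIsometry_of_thetaObjective_eq hN S hSr hS.thetaFeasible
      (by rw [hS.thetaObjective_eq, hval]; ring)
    let x₀ : Fin N := ⟨0, by omega⟩
    obtain ⟨hAfin, hAdim⟩ := finrank_eq_two_of_sum_eq_id (hSr.1 x₀) (hS.1 x₀) VA
    obtain ⟨hBfin, hBdim⟩ := finrank_eq_two_of_sum_eq_id (hSr.2 x₀) (hS.2 x₀) VB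
    exact ⟨VA.toLinearIsometryEquiv hAdim, VB.toLinearIsometryEquiv hBdim, h1, h2⟩
  · intro HA HB _ _ _ _ S hS hopt
    exact exists_linearIsometry_of_thetaObjective_eq hN S hS hopt.1 (hopt.thetaObjective_eq hN)
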